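/- Let $\gamma,v_0,V^0>0$ and let $J=[0,\infty)$ or $J=\mathbb R$. Let $g:J\to\mathbb R$ be nonincreasing and differentiable with bounded derivative, and $-V^0\le g\le -v_0$ on $J$. For $\alpha\ge 0$ let $C_\alpha$ be the space of continuous $u:\mathbb R\to\mathbb R$ with $|u|_\alpha=\sup_x e^{\alpha|x|}|u(x)|<\infty$, with the metric of this norm, and let $C_\alpha^J$ be the set of $u\in C_\alpha$ with values in $J$. Let $G(x,t,\xi,\tau)=(4\pi(t-\tau))^{-1/2}e^{-(x-\xi)^2/(4(t-\tau))}$ and consider, for $u_0\in C_\alpha^J$, the solution $$u(x,t)=u_2(x,t)+u_1(x,t),\quad u_2(x,t)=e^{-\gamma t}\int_{\mathbb R}G(x,t,\xi,0)u_0(\xi)\,d\xi,\quad u_1(x,t)=-\int_0^t e^{-\gamma(t-\tau)}G(x,t,s(\tau),\tau)v(\tau)\,d\tau$$ (with $u_2(\cdot,0)=u_0$) of the free-interface problem $u_t=u_{xx}-\gamma u$ for $x\ne s(t)$, $[u_x]_{x=s(t)}=v(t)=g(u(s(t),t))$, $u(\cdot,0)=u_0$, where $s(t)=\int_0^t v(\tau)\,d\tau$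 and the velocity $v$ is the continuous function on $[0,\infty)$ with $u(s(t),t)\in J$ and $v(t)=g(u(s(t),t))$ for all $t\ge0$. In the frame attached to the interface put $(T_i(t)u_0)(x)=u_i(x+s(t),t)$, $i=1,2$, and $T(t)=T_1(t)+T_2(t)$. Let $$\alpha_{time}=\tfrac{V^0}{2}\Bigl(\sqrt{1+4\gamma/(V^0)^2}-1\Bigr),\qquad \alpha_{space}=\min\Bigl(\tfrac{v_0}{4},\tfrac{\gamma}{2V^0}\Bigr),\qquad \kappa=\gamma-\alpha^2-\alpha V^0 .$$ 1. Let $0\le\alpha<\alpha_{time}$. Then for every $u_0\in C^J_\alpha$ the velocity $v$ exists and is unique, $T_1(t)u_0,T_2(t)u_0\in C_\alpha$ for $t\ge0$, and the $T(t)$ form a semigroup of maps of $C^J_\alpha$ into itself. Moreover $\kappa>0$, $|T_2(t)u_0|_\alpha\le 2e^{-\kappa t}N$ whenever $u_0\in C_\alpha^J$, $|u_0|_\alpha\le N$ and $t\ge 0$, and for every $\varepsilon>0$ the ball $B_a=\{u\in C^J_\alpha:|u|_\alpha\le V^0/\sqrt\gamma+\varepsilon\}$ is absorbing: for each bounded $X\subset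 C_\alpha^J$ there is $t_1$ with $T(t)X\subset B_a$ for all $t\ge t_1$. 2. Let $0\le\alpha<\alpha_{space}$. Then for every ball $X=\{u\in C^J_\alpha:|u|_\alpha\le N\}$ and every $t_0>0$ the set $\bigcup_{t\ge t_0}T_1(t)X$ is relatively compact in $C_\alpha$. 3. Let $0\le\alpha<\min(\alpha_{time},\alpha_{space})$ and $\varepsilon>0$. Then the $\omega$-limit set $\mathcal A_\alpha=\bigcap_{r\ge0}\overline{\bigcup_{t\ge r}T(t)B_a}$ is a global attractor: it is a compact subset of $C_\alpha^J$, $T(t)\mathcal A_\alpha=\mathcal A_\alpha$ for all $t\ge0$, and it attracts every bounded $X\subset C_\alpha^J$ uniformly, i.e. $\sup_{u\in X}\operatorname{dist}(T(t)u,\mathcal A_\alpha)\to0$ as $t\to\infty$. It is maximal: every bounded $Y\subset C_\alpha^J$ with $T(t)Y=Y$ for all $t\ge0$ lies in $\mathcal A_\alpha$. It is connected (and nonempty). Furthermore there is a compact set $K$ with $\mathcal A_\alpha\subset K\subset C_\alpha^J$ that attracts bounded sets exponentially: for each bounded $X\subset C^J_\alpha$ there is $C$ with $\operatorname{dist}(T(t)u,K)\le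 Ce^{-\kappa t}$ for all $u\in X$, $t\ge0$. -/

import Mathlib

namespace Stefan

/-! ### The weighted spaces `C_α` -/

/-- The continuous functions `f` on the line for which `e^{α|x|} |f x|` is bounded. -/
def weightedSubmodule (α : ℝ) : Submodule ℝ (ℝ → ℝ) where
  carrier := {f | Continuous f ∧ BddAbove (Set.range fun x => Real.exp (α * |x|) * |f x|)}
  zero_mem' := ⟨continuous_const, ⟨0, by rintro _ ⟨x, rfl⟩; simp⟩⟩
  add_mem' := by
    rintro f h ⟨hf, A, hA⟩ ⟨hh, B, hB⟩
    refine ⟨hf.add hh, A + B, ?_⟩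
    rintro _ ⟨x, rfl⟩
    have h1 := hA ⟨x, rfl⟩
    have h2 := hB ⟨x, rfl⟩
    have h3 := mul_le_mul_of_nonneg_left (abs_add_le (f x) (h x)) (Real.exp_pos (α * |x|)).le
    simp only [Pi.add_apply] at *
    linarith
  smul_mem' := by
    rintro c f ⟨hf, A, hA⟩
    refine ⟨hf.const_smul c, |c| * A, ?_⟩
    rintro _ ⟨x, rfl⟩
    have h1 := mul_le_mul_of_nonneg_left (hA ⟨x, rfl⟩) (abs_nonneg c)
    simp only [Pi.smul_apply, smul_eq_mul, abs_mul] at *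
    linarith

/-- The space `C_α`, as a type of its own, so that its topology is the one of the weighted norm
(and not that of pointwise convergence). -/
def WeightedC (α : ℝ) : Type := weightedSubmodule α

namespace WeightedC

variable {α : ℝ}

noncomputable instance : AddCommGroup (WeightedC α) :=
  inferInstanceAs (AddCommGroup (weightedSubmodule α))

noncomputable instance : Module ℝ (WeightedC α) :=
  inferInstanceAs (Module ℝ (weightedSubmodule α))

instance : CoeFun (WeightedC α) (fun _ => ℝ → ℝ) := ⟨fun u => u.1⟩

theorem bddAbove (u : WeightedC α) :
    BddAbove (Set.range fun x => Real.exp (α * |x|) * |u x|) := u.2.2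

/-- The norm `|u|_α = sup_x e^{α|x|} |u x|`. -/
noncomputable def weightedNorm (α : ℝ) : AddGroupNorm (WeightedC α) where
  toFun u := ⨆ x : ℝ, Real.exp (α * |x|) * |u x|
  map_zero' := by
    have h : ∀ x : ℝ, (0 : WeightedC α) x = 0 := fun _ => rfl
    simp [h]
  add_le' u w := by
    refine ciSup_le fun x => ?_
    have h0 : (u + w) x = u x + w x := rfl
    have h1 := le_ciSup u.bddAbove x
    have h2 := le_ciSup w.bddAbove x
    have h3 := mul_le_mul_of_nonneg_left (abs_add_le (u x) (w x)) (Real.exp_pos (α * |x|)).le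
    rw [h0]
    linarith
  neg' u := by
    have h : ∀ x : ℝ, (-u) x = -u x := fun _ => rfl
    simp [h]
  eq_zero_of_map_eq_zero' u hu := by
    refine Subtype.ext (funext fun x => ?_)
    have h1 := le_ciSup u.bddAbove x
    have h2 : Real.exp (α * |x|) * |u x| ≤ 0 := h1.trans hu.le
    have h3 : |u x| ≤ 0 := nonpos_of_mul_nonpos_right h2 (Real.exp_pos _)
    exact abs_nonpos_iff.1 h3

noncomputable instance : NormedAddCommGroup (WeightedC α) :=
  (weightedNorm α).toNormedAddCommGroup

theorem norm_def (u : WeightedC α) : ‖u‖ = ⨆ x : ℝ, Real.exp (α * |x|) * |u x| := rfl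

open Classical in
/-- A function on the line as an element of `C_α` (with value `0` if it does not lie there). -/
noncomputable def ofFun (α : ℝ) (f : ℝ → ℝ) : WeightedC α :=
  if h : f ∈ weightedSubmodule α then ⟨f, h⟩ else 0

end WeightedC

/-! ### The kinetics and the free interface -/

/-- Admissible kinetic functions `g`, defined for temperatures in `J`. -/
structure IsKinetics (J : Set ℝ) (g : ℝ → ℝ) (v₀ V₀ : ℝ) : Prop where
  antitone : AntitoneOn g J
  differentiable : DifferentiableOn ℝ g J
  deriv_bounded : ∃ C : ℝ, ∀ u ∈ J, |derivWithin g J u| ≤ C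
  bounds : ∀ u ∈ J, -V₀ ≤ g u ∧ g u ≤ -v₀

/-- The heat kernel `G(x,t,ξ,τ)`. -/
noncomputable def heatKernel (x t ξ τ : ℝ) : ℝ :=
  Real.exp (-(x - ξ) ^ 2 / (4 * (t - τ))) / Real.sqrt (4 * Real.pi * (t - τ))

/-- The interface position `s(t) = ∫₀ᵗ v`. -/
noncomputable def front (v : ℝ → ℝ) (t : ℝ) : ℝ := ∫ τ in (0 : ℝ)..t, v τ

/-- The single layer potential of the interface, at the point `x` of the fixed frame. -/
noncomputable def interfacePart (γ : ℝ) (v : ℝ → ℝ) (t x : ℝ) : ℝ :=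
  -∫ τ in (0 : ℝ)..t, Real.exp (-γ * (t - τ)) * heatKernel x t (front v τ) τ * v τ

/-- The contribution of the initial data, at the point `x` of the fixed frame. -/
noncomputable def initialPart (γ : ℝ) (u₀ : ℝ → ℝ) (t x : ℝ) : ℝ :=
  if t = 0 then u₀ x else Real.exp (-γ * t) * ∫ ξ : ℝ, heatKernel x t ξ 0 * u₀ ξ

/-- The temperature `u(x,t)` in the fixed frame. -/
noncomputable def temperature (γ : ℝ) (u₀ v : ℝ → ℝ) (t x : ℝ) : ℝ :=
  initialPart γ u₀ t x + interfacePart γ v t x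

/-- `v` is the interface velocity for the initial data `u₀`: the temperature at the interface
stays in the domain `J` of `g` and the kinetic condition `v(t) = g(u(s(t),t))` holds, with `u` given
by the potentials; this is the integral equation for `v`. -/
structure IsVelocity (J : Set ℝ) (g : ℝ → ℝ) (γ : ℝ) (u₀ v : ℝ → ℝ) : Prop where
  continuousOn : ContinuousOn v (Set.Ici 0)
  mem : ∀ t : ℝ, 0 ≤ t → temperature γ u₀ v t (front v t) ∈ J
  kinetic : ∀ t : ℝ, 0 ≤ t → v t = g (temperature γ u₀ v t (front v t))

/-- The interface velocity issuing from `u₀`. -/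
noncomputable def velocity (J : Set ℝ) (g : ℝ → ℝ) (γ : ℝ) (u₀ : ℝ → ℝ) : ℝ → ℝ :=
  Classical.epsilon (IsVelocity J g γ u₀)

/-! ### The evolution operators, in the frame attached to the interface -/

/-- `x ↦ (T₁(t)u₀)(x)`, where `x` is the coordinate relative to the interface. -/
noncomputable def profile₁ (J : Set ℝ) (g : ℝ → ℝ) (γ t : ℝ) (u₀ : ℝ → ℝ) (x : ℝ) : ℝ :=
  interfacePart γ (velocity J g γ u₀) t (x + front (velocity J g γ u₀) t)

/-- `x ↦ (T₂(t)u₀)(x)`, where `x` is the coordinate relative to the interface. -/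
noncomputable def profile₂ (J : Set ℝ) (g : ℝ → ℝ) (γ t : ℝ) (u₀ : ℝ → ℝ) (x : ℝ) : ℝ :=
  initialPart γ u₀ t (x + front (velocity J g γ u₀) t)

/-- `T₁(t)` on `C_α`. -/
noncomputable def T₁ (J : Set ℝ) (g : ℝ → ℝ) (γ α t : ℝ) (u : WeightedC α) : WeightedC α :=
  WeightedC.ofFun α (profile₁ J g γ t u)

/-- `T₂(t)` on `C_α`. -/
noncomputable def T₂ (J : Set ℝ) (g : ℝ → ℝ) (γ α t : ℝ) (u : WeightedC α) : WeightedC α :=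
  WeightedC.ofFun α (profile₂ J g γ t u)

/-- The evolution operator `T(t) = T₁(t) + T₂(t)`. -/
noncomputable def T (J : Set ℝ) (g : ℝ → ℝ) (γ α t : ℝ) (u : WeightedC α) : WeightedC α :=
  T₁ J g γ α t u + T₂ J g γ α t u

/-- The admissible states: elements of `C_α` with values in the domain `J` of the kinetics. -/
def phaseSpace (J : Set ℝ) (α : ℝ) : Set (WeightedC α) := {u | ∀ x, u x ∈ J}

/-- The ball of radius `r` in the phase space. -/
def ball (J : Set ℝ) (α r : ℝ) : Set (WeightedC α) := {u | u ∈ phaseSpace J α ∧ ‖u‖ ≤ r}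

/-- The evolution is well defined on the phase space: the interface velocity exists and is unique,
both contributions lie in `C_α`, the phase space is mapped to itself, and `T` is a semigroup. -/
structure IsWellDefined (J : Set ℝ) (g : ℝ → ℝ) (γ α : ℝ) : Prop where
  velocity_unique : ∀ u ∈ phaseSpace J α, ∃ v, IsVelocity J g γ u v ∧
    ∀ w, IsVelocity J g γ u w → Set.EqOn w v (Set.Ici 0)
  profile₁_mem : ∀ u ∈ phaseSpace J α, ∀ t : ℝ, 0 ≤ t → profile₁ J g γ t u ∈ weightedSubmodule α
  profile₂_mem : ∀ u ∈ phaseSpace J α, ∀ t : ℝ, 0 ≤ t → profile₂ J g γ t u ∈ weightedSubmodule α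
  mapsTo : ∀ t : ℝ, 0 ≤ t → Set.MapsTo (T J g γ α t) (phaseSpace J α) (phaseSpace J α)
  zero : ∀ u ∈ phaseSpace J α, T J g γ α 0 u = u
  add : ∀ u ∈ phaseSpace J α, ∀ t r : ℝ, 0 ≤ t → 0 ≤ r →
    T J g γ α (t + r) u = T J g γ α t (T J g γ α r u)

/-! ### Absorbing sets and attractors of an evolution `S(t)`, `t ≥ 0`, on a set `P` -/

/-- `B` absorbs the bounded subsets of `P`. -/
def IsAbsorbing {E : Type*} [PseudoMetricSpace E] (S : ℝ → E → E) (P B : Set E) : Prop :=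
  ∀ X ⊆ P, Bornology.IsBounded X → ∃ t₁ : ℝ, 0 ≤ t₁ ∧ ∀ t ≥ t₁, S t '' X ⊆ B

/-- `A` is a compact invariant set that attracts the bounded subsets of `P` uniformly. -/
structure IsGlobalAttractor {E : Type*} [PseudoMetricSpace E] (S : ℝ → E → E) (P A : Set E) :
    Prop where
  subset : A ⊆ P
  isCompact : IsCompact A
  invariant : ∀ t : ℝ, 0 ≤ t → S t '' A = A
  attracts : ∀ X ⊆ P, Bornology.IsBounded X → ∀ δ > 0, ∃ t₁ : ℝ, 0 ≤ t₁ ∧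
    ∀ t ≥ t₁, S t '' X ⊆ Metric.thickening δ A

/-- `A` contains every bounded invariant subset of `P`, in particular every bounded attractor. -/
def IsMaximalInvariant {E : Type*} [PseudoMetricSpace E] (S : ℝ → E → E) (P A : Set E) : Prop :=
  ∀ Y ⊆ P, Bornology.IsBounded Y → (∀ t : ℝ, 0 ≤ t → S t '' Y = Y) → Y ⊆ A

/-- `K` attracts the bounded subsets of `P` at the exponential rate `κ`. -/
def AttractsExponentially {E : Type*} [PseudoMetricSpace E] (S : ℝ → E → E) (P K : Set E)
    (κ : ℝ) : Prop :=
  ∀ X ⊆ P, Bornology.IsBounded X → ∃ C : ℝ, ∀ t : ℝ, 0 ≤ t → ∀ u ∈ X,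
    ∃ k ∈ K, dist (S t u) k ≤ C * Real.exp (-κ * t)

/-! ### The critical weights -/

noncomputable def alphaTime (γ V₀ : ℝ) : ℝ := V₀ / 2 * (Real.sqrt (1 + 4 * γ / V₀ ^ 2) - 1)

noncomputable def alphaSpace (γ v₀ V₀ : ℝ) : ℝ := min (v₀ / 4) (γ / (2 * V₀))

/-- The decay rate `κ(γ,α) = γ - α² - α V⁰`. -/
def kappa (γ V₀ α : ℝ) : ℝ := γ - α ^ 2 - α * V₀

end Stefan

open MeasureTheory Set Filter Topology

namespace Stefan

/-! ### The Gaussian kernel -/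

/-! The motion splits into a contracting part and a part confined to a compact set. In the moving
frame `T₂` is damped heat flow followed by a translation by at most `V₀ t`; in the weight `e^{α|x|}`
these cost the factors `e^{(α²-γ)t}` and `e^{αV₀t}`, whose product is `e^{-κt}` (`norm_T₂_le`). The
potentials `T₁` share one bound `V₀/√γ · e^{-β|x|}` for every `β ≥ 0` with `κ(β) > 0`, and one
Hölder-1/2 modulus (`profile₁_mem_decayClass`), uniformly in time and data. Taking `β > α` makes the
class of such functions compact in `C_α`, by an Ascoli argument with controlled tails
(`isCompact_image_decayClass`).

The decay of `T₁` comes from a discrete barrier argument (`interfacePart_add_le_exp`,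
`interfacePart_le_exp`). Near the interface the crude bound `V₀/(2√γ)` is half the barrier
amplitude. Farther out, a step of length `h` contracts the barrier by `e^{-κh}`, while the newly
emitted heat is only of order `h^{3/2}`; for small `h` the barrier is therefore reproduced with the
same constant.

The velocity is a Banach fixed point in a sup norm weighted by `e^{-λt}`: the temperature at the
interface depends on the velocity with Lipschitz constant of order `λ^{-1/2}`
(`abs_temperature_sub_le`). Iterating the same estimate gives uniqueness and continuous dependence
(`abs_velocity_sub_le`). The kinetics are first extended to a Lipschitz function on the line; since
velocities are negative, the interface emits a nonnegative potential and the solution stays in `J`.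
Uniqueness together with Chapman–Kolmogorov (`interfacePart_add`) gives the semigroup law.

Exponential attraction to a compact set gives asymptotic compactness, so the usual sequential
arguments show that the omega-limit set of the absorbing ball is an attractor, and convexity of the
ball makes it connected. Both critical weights force `κ > 0`, so a single compactness argument
serves all three assertions. -/

/-- The Gaussian kernel `(4πr)^{-1/2} e^{-y²/(4r)}`. -/
noncomputable def gauss (r y : ℝ) : ℝ :=
  Real.exp (-y ^ 2 / (4 * r)) / Real.sqrt (4 * Real.pi * r)

theorem heatKernel_eq_gauss (x t ξ τ : ℝ) : heatKernel x t ξ τ = gauss (t - τ) (x - ξ) := rfl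

theorem gauss_nonneg (r y : ℝ) : 0 ≤ gauss r y := by
  unfold gauss; positivity

theorem gauss_le {r : ℝ} (hr : 0 ≤ r) (y : ℝ) : gauss r y ≤ 1 / Real.sqrt (4 * Real.pi * r) := by
  unfold gauss
  gcongr
  rw [Real.exp_le_one_iff, neg_div]
  have : 0 ≤ y ^ 2 / (4 * r) := by positivity
  linarith

theorem measurable_gauss {Ω : Type*} [MeasurableSpace Ω] {f h : Ω → ℝ} (hf : Measurable f)
    (hh : Measurable h) : Measurable (fun ω => gauss (f ω) (h ω)) := by
  unfold gauss; fun_prop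

theorem continuous_gauss (r : ℝ) : Continuous (gauss r) := by
  unfold gauss; fun_prop

theorem gauss_eq_exp_mul (r y : ℝ) :
    gauss r y = Real.exp (-(1 / (4 * r)) * y ^ 2) / Real.sqrt (4 * Real.pi * r) := by
  unfold gauss
  congr 2
  ring

theorem integrable_gauss {r : ℝ} (hr : 0 < r) : Integrable (gauss r) := by
  have h := (integrable_exp_neg_mul_sq (b := 1 / (4 * r)) (by positivity)).div_const
    (Real.sqrt (4 * Real.pi * r))
  exact h.congr (Eventually.of_forall fun y => (gauss_eq_exp_mul r y).symm)

theorem integral_gauss {r : ℝ} (hr : 0 < r) : ∫ y, gauss r y = 1 := by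
  simp_rw [gauss_eq_exp_mul]
  rw [integral_div, integral_gaussian]
  have : Real.pi / (1 / (4 * r)) = 4 * Real.pi * r := by field_simp
  rw [this]
  have := Real.pi_pos
  exact div_self (by positivity)

/-- Completing the square turns an exponential tilt into a translation by `2βr`, so exponential
moments reduce to the unit mass. -/
theorem gauss_mul_exp {r : ℝ} (hr : 0 < r) (β y : ℝ) :
    gauss r y * Real.exp (β * y) = Real.exp (β ^ 2 * r) * gauss r (y - 2 * β * r) := by
  unfold gauss
  rw [div_mul_eq_mul_div, ← mul_div_assoc, ← Real.exp_add, ← Real.exp_add]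
  congr 2
  field_simp
  ring

theorem integrable_gauss_mul_exp {r : ℝ} (hr : 0 < r) (β : ℝ) :
    Integrable (fun y => gauss r y * Real.exp (β * y)) := by
  simp_rw [gauss_mul_exp hr]
  exact ((integrable_gauss hr).comp_sub_right _).const_mul _

theorem integral_gauss_mul_exp {r : ℝ} (hr : 0 < r) (β : ℝ) :
    ∫ y, gauss r y * Real.exp (β * y) = Real.exp (β ^ 2 * r) := by
  simp_rw [gauss_mul_exp hr]
  rw [integral_const_mul, integral_sub_right_eq_self (gauss r), integral_gauss hr, mul_one]

theorem exp_mul_abs_le (α y : ℝ) :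
    Real.exp (α * |y|) ≤ Real.exp (α * y) + Real.exp (-α * y) := by
  rcases abs_cases y with ⟨h, _⟩ | ⟨h, _⟩ <;> rw [h]
  · linarith [Real.exp_pos (-α * y)]
  · rw [show α * -y = -α * y by ring]
    linarith [Real.exp_pos (α * y)]

theorem integrable_gauss_mul_exp_abs {r : ℝ} (hr : 0 < r) (α : ℝ) :
    Integrable (fun y => gauss r y * Real.exp (α * |y|)) := by
  refine ((integrable_gauss_mul_exp hr α).add (integrable_gauss_mul_exp hr (-α))).mono'
    ((continuous_gauss r).mul (by fun_prop)).aestronglyMeasurable (Eventually.of_forall fun y => ?_)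
  rw [Real.norm_of_nonneg (mul_nonneg (gauss_nonneg _ _) (Real.exp_pos _).le)]
  simp only [Pi.add_apply]
  rw [← mul_add]
  exact mul_le_mul_of_nonneg_left (exp_mul_abs_le α y) (gauss_nonneg _ _)

theorem integral_gauss_mul_exp_abs_le {r : ℝ} (hr : 0 < r) (α : ℝ) :
    ∫ y, gauss r y * Real.exp (α * |y|) ≤ 2 * Real.exp (α ^ 2 * r) := by
  have h1 := integrable_gauss_mul_exp hr α
  have h2 := integrable_gauss_mul_exp hr (-α)
  calc ∫ y, gauss r y * Real.exp (α * |y|)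
      ≤ ∫ y, (gauss r y * Real.exp (α * y) + gauss r y * Real.exp (-α * y)) := by
        refine integral_mono (integrable_gauss_mul_exp_abs hr α) (h1.add h2) fun y => ?_
        simp only
        rw [← mul_add]
        exact mul_le_mul_of_nonneg_left (exp_mul_abs_le α y) (gauss_nonneg _ _)
    _ = 2 * Real.exp (α ^ 2 * r) := by
        rw [integral_add h1 h2, integral_gauss_mul_exp hr, integral_gauss_mul_exp hr]
        ring_nf

/-- Completing the square in `ξ` isolates a single normalized Gaussian in that variable; integrating
it out is the semigroup property. -/
theorem gauss_mul_gauss {a b : ℝ} (ha : 0 < a) (hb : 0 < b) (x ξ η : ℝ) :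
    gauss a (x - ξ) * gauss b (ξ - η) =
      gauss (a + b) (x - η) * gauss (a * b / (a + b)) (ξ - (b * x + a * η) / (a + b)) := by
  have hab : 0 < a + b := by positivity
  have hpi := Real.pi_pos
  unfold gauss
  rw [div_mul_div_comm, div_mul_div_comm, ← Real.exp_add, ← Real.exp_add,
    ← Real.sqrt_mul (by positivity), ← Real.sqrt_mul (by positivity)]
  congr 2
  · field_simp
    ring
  · field_simp

/-- The Chapman–Kolmogorov identity. -/
theorem integral_gauss_mul_gauss {a b : ℝ} (ha : 0 < a) (hb : 0 < b) (x η : ℝ) :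
    ∫ ξ, gauss a (x - ξ) * gauss b (ξ - η) = gauss (a + b) (x - η) := by
  simp_rw [gauss_mul_gauss ha hb]
  rw [integral_const_mul, integral_sub_right_eq_self (gauss (a * b / (a + b))),
    integral_gauss (by positivity), mul_one]

theorem integrable_gauss_mul_gauss {a b : ℝ} (ha : 0 < a) (hb : 0 < b) (x η : ℝ) :
    Integrable (fun ξ => gauss a (x - ξ) * gauss b (ξ - η)) := by
  simp_rw [gauss_mul_gauss ha hb]
  exact ((integrable_gauss (by positivity)).comp_sub_right _).const_mul _

/-- Heat flow of a superposition of Gaussians. -/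
theorem integral_gauss_mul_superposition {μ : Measure ℝ} [SFinite μ] {b : ℝ} (hb : 0 < b)
    {ρ p h : ℝ → ℝ} (hρ : ∀ᵐ ω ∂μ, 0 < ρ ω) (hρm : Measurable ρ) (hpm : Measurable p)
    (hhm : Measurable h) (x : ℝ)
    (hint : Integrable (fun ω => gauss (b + ρ ω) (x - p ω) * h ω) μ) :
    ∫ ξ, gauss b (x - ξ) * ∫ ω, gauss (ρ ω) (ξ - p ω) * h ω ∂μ =
      ∫ ω, gauss (b + ρ ω) (x - p ω) * h ω ∂μ := by
  have hm : Measurable (Function.uncurry fun (ξ ω : ℝ) =>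
      gauss b (x - ξ) * (gauss (ρ ω) (ξ - p ω) * h ω)) := by
    have h1 : Measurable fun q : ℝ × ℝ => gauss b (x - q.1) :=
      measurable_gauss measurable_const (measurable_const.sub measurable_fst)
    have h2 : Measurable fun q : ℝ × ℝ => gauss (ρ q.2) (q.1 - p q.2) :=
      measurable_gauss (hρm.comp measurable_snd) (measurable_fst.sub (hpm.comp measurable_snd))
    exact h1.mul (h2.mul (hhm.comp measurable_snd))
  -- Fubini: the kernels are nonnegative, so integrating the norm over `ξ` first gives, by
  -- Chapman–Kolmogorov, exactly the norm of the integrand in `hint`.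
  have key : Integrable (Function.uncurry fun (ξ ω : ℝ) =>
      gauss b (x - ξ) * (gauss (ρ ω) (ξ - p ω) * h ω)) (volume.prod μ) := by
    rw [integrable_prod_iff' hm.aestronglyMeasurable]
    constructor
    · filter_upwards [hρ] with ω hω
      simp only [Function.uncurry, ← mul_assoc]
      exact (integrable_gauss_mul_gauss hb hω x (p ω)).mul_const _
    · refine hint.norm.congr ?_
      filter_upwards [hρ] with ω hω
      simp only [Function.uncurry, ← mul_assoc, norm_mul, Real.norm_of_nonneg (gauss_nonneg _ _)]
      rw [integral_mul_const, integral_gauss_mul_gauss hb hω]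
  simp_rw [← integral_const_mul]
  rw [integral_integral_swap key]
  refine integral_congr_ae ?_
  filter_upwards [hρ] with ω hω
  simp only [← mul_assoc]
  rw [integral_mul_const, integral_gauss_mul_gauss hb hω]

/-! ### Lipschitz estimates for the kernel -/

theorem abs_exp_neg_sq_sub_le (a b : ℝ) :
    |Real.exp (-a ^ 2) - Real.exp (-b ^ 2)| ≤ |a - b| := by
  have hd : ∀ x : ℝ, HasDerivAt (fun x : ℝ => Real.exp (-x ^ 2)) (Real.exp (-x ^ 2) * -(2 * x)) x := by
    intro x
    have := ((hasDerivAt_pow 2 x).fun_neg).exp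
    simpa using this
  have h := Convex.norm_image_sub_le_of_norm_deriv_le (f := fun x : ℝ => Real.exp (-x ^ 2))
    (s := univ) (C := 1) (x := b) (y := a) (fun x _ => (hd x).differentiableAt)
    (fun x _ => by
      rw [(hd x).deriv, Real.norm_eq_abs, abs_mul, abs_of_pos (Real.exp_pos _), abs_neg, Real.exp_neg,
        inv_mul_le_iff₀ (Real.exp_pos _), mul_one]
      have h1 := Real.add_one_le_exp (x ^ 2)
      have h2 : |2 * x| ≤ x ^ 2 + 1 := abs_le.2 ⟨by nlinarith [sq_nonneg (x + 1)], by nlinarith [sq_nonneg (x - 1)]⟩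
      linarith) convex_univ trivial trivial
  simpa using h

/-- Difference of squares of `e^{-x²/2}`: one factor is Lipschitz, the other retains Gaussian tails.
-/
theorem abs_exp_neg_sq_sub_le_mul (a b : ℝ) :
    |Real.exp (-a ^ 2) - Real.exp (-b ^ 2)| ≤
      |a - b| * (Real.exp (-a ^ 2 / 2) + Real.exp (-b ^ 2 / 2)) := by
  have e : ∀ x : ℝ, Real.exp (-x ^ 2) = Real.exp (-x ^ 2 / 2) * Real.exp (-x ^ 2 / 2) := by
    intro x; rw [← Real.exp_add]; ring_nf
  have e' : ∀ x : ℝ, Real.exp (-x ^ 2 / 2) = Real.exp (-(x / √2) ^ 2) := by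
    intro x; rw [div_pow, Real.sq_sqrt (by norm_num)]; ring_nf
  have h : |Real.exp (-a ^ 2 / 2) - Real.exp (-b ^ 2 / 2)| ≤ |a - b| := by
    rw [e', e']
    refine (abs_exp_neg_sq_sub_le _ _).trans ?_
    rw [← sub_div, abs_div]
    refine div_le_self (abs_nonneg _) ?_
    rw [abs_of_nonneg (Real.sqrt_nonneg _)]
    exact Real.one_le_sqrt.2 (by norm_num)
  have hs : Real.exp (-a ^ 2) - Real.exp (-b ^ 2) =
      (Real.exp (-a ^ 2 / 2) - Real.exp (-b ^ 2 / 2)) *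
        (Real.exp (-a ^ 2 / 2) + Real.exp (-b ^ 2 / 2)) := by
    rw [e a, e b]; ring
  rw [hs, abs_mul]
  rw [abs_of_pos (a := Real.exp (-a ^ 2 / 2) + Real.exp (-b ^ 2 / 2)) (by positivity)]
  gcongr

theorem div_two_sqrt_sq {r : ℝ} (hr : 0 < r) (y : ℝ) : (y / (2 * √r)) ^ 2 = y ^ 2 / (4 * r) := by
  rw [div_pow, mul_pow, Real.sq_sqrt hr.le]; norm_num

theorem abs_gauss_sub_le {r : ℝ} (hr : 0 < r) (y z : ℝ) :
    |gauss r y - gauss r z| ≤ |y - z| / (2 * √r) / Real.sqrt (4 * Real.pi * r) := by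
  have h := abs_exp_neg_sq_sub_le (y / (2 * √r)) (z / (2 * √r))
  rw [div_two_sqrt_sq hr, div_two_sqrt_sq hr, ← sub_div, abs_div, ← neg_div, ← neg_div,
    abs_of_pos (a := 2 * √r) (by positivity)] at h
  unfold gauss
  rw [← sub_div, abs_div, abs_of_nonneg (Real.sqrt_nonneg _)]
  gcongr

/-- Unlike the uniform bound `abs_gauss_sub_le`, this keeps Gaussians (at the doubled time), so it
can be integrated against exponentially weighted data. -/
theorem abs_gauss_sub_le_mul {r : ℝ} (hr : 0 < r) (y z : ℝ) :
    |gauss r y - gauss r z| ≤ |y - z| / √r * (gauss (2 * r) y + gauss (2 * r) z) := by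
  have h := abs_exp_neg_sq_sub_le_mul (y / (2 * √r)) (z / (2 * √r))
  rw [div_two_sqrt_sq hr, div_two_sqrt_sq hr, ← sub_div, abs_div, ← neg_div, ← neg_div,
    abs_of_pos (a := 2 * √r) (by positivity)] at h
  have hpi := Real.pi_pos
  have hs : √(4 * Real.pi * (2 * r)) ≤ 2 * √(4 * Real.pi * r) := by
    rw [Real.sqrt_le_left (by positivity), mul_pow, Real.sq_sqrt (by positivity)]
    nlinarith [mul_pos hpi hr]
  have e : ∀ y : ℝ, Real.exp (-y ^ 2 / (4 * r) / 2) / (2 * √(4 * Real.pi * r)) ≤ gauss (2 * r) y := by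
    intro y
    unfold gauss
    rw [show -y ^ 2 / (4 * (2 * r)) = -y ^ 2 / (4 * r) / 2 by field_simp]
    gcongr
  have hy := e y
  have hz := e z
  calc |gauss r y - gauss r z|
      = |Real.exp (-y ^ 2 / (4 * r)) - Real.exp (-z ^ 2 / (4 * r))| / √(4 * Real.pi * r) := by
        unfold gauss
        rw [← sub_div, abs_div, abs_of_nonneg (Real.sqrt_nonneg _)]
    _ ≤ |y - z| / (2 * √r) * (Real.exp (-y ^ 2 / (4 * r) / 2) + Real.exp (-z ^ 2 / (4 * r) / 2)) /
          √(4 * Real.pi * r) := by gcongr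
    _ = |y - z| / √r * (Real.exp (-y ^ 2 / (4 * r) / 2) / (2 * √(4 * Real.pi * r)) +
          Real.exp (-z ^ 2 / (4 * r) / 2) / (2 * √(4 * Real.pi * r))) := by
        field_simp
    _ ≤ _ := by gcongr

/-! ### The weakly singular time kernel -/

/-- The time kernel `(4πr)^{-1/2} e^{-γr}`. -/
noncomputable def timeKernel (γ r : ℝ) : ℝ := Real.exp (-γ * r) / Real.sqrt (4 * Real.pi * r)

theorem timeKernel_nonneg (γ r : ℝ) : 0 ≤ timeKernel γ r := by
  unfold timeKernel; positivity

theorem timeKernel_eq {γ r : ℝ} (hr : 0 < r) :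
    timeKernel γ r = 1 / Real.sqrt (4 * Real.pi) * (r ^ ((1 / 2 : ℝ) - 1) * Real.exp (-(γ * r))) := by
  have hpi := Real.pi_pos
  unfold timeKernel
  rw [Real.sqrt_mul (by positivity), Real.rpow_sub_one hr.ne', ← Real.sqrt_eq_rpow, neg_mul]
  have : √r * √r = r := Real.mul_self_sqrt hr.le
  have h2 : √r ≠ 0 := by positivity
  have h3 : √r / r = 1 / √r := by
    rw [div_eq_div_iff hr.ne' h2, one_mul, this]
  rw [h3]
  field_simp

theorem integrableOn_timeKernel {γ : ℝ} (hγ : 0 < γ) : IntegrableOn (timeKernel γ) (Ioi 0) := by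
  have h := integrableOn_rpow_mul_exp_neg_mul_rpow (p := 1) (s := (1 / 2 : ℝ) - 1) (b := γ)
    (by norm_num) (by norm_num) hγ
  have h' := h.const_mul (1 / Real.sqrt (4 * Real.pi))
  refine IntegrableOn.congr_fun h' (fun r hr => ?_) measurableSet_Ioi
  rw [timeKernel_eq hr]
  simp

/-- This is `Γ(1/2) = √π`. The value is what bounds every interface potential by `V/(2√γ)`, half the
amplitude of the barrier used later. -/
theorem integral_timeKernel {γ : ℝ} (hγ : 0 < γ) :
    ∫ r in Ioi 0, timeKernel γ r = 1 / (2 * √γ) := by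
  rw [setIntegral_congr_fun measurableSet_Ioi (fun r hr => timeKernel_eq hr), integral_const_mul,
    Real.integral_rpow_mul_exp_neg_mul_Ioi (by norm_num) hγ, Real.Gamma_one_half_eq,
    ← Real.sqrt_eq_rpow, Real.sqrt_mul (by norm_num), Real.sqrt_div (by norm_num),
    show √4 = 2 by rw [show (4 : ℝ) = 2 ^ 2 by norm_num]; exact Real.sqrt_sq (by norm_num)]
  have : √Real.pi ≠ 0 := by have := Real.pi_pos; positivity
  simp
  field_simp

/-! ### The potential of the initial data -/

theorem integrable_gauss_mul {t N : ℝ} (ht : 0 < t) {u : ℝ → ℝ} (hu : Continuous u)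
    (hN : ∀ x, |u x| ≤ N) (x : ℝ) : Integrable (fun ξ => gauss t (x - ξ) * u ξ) := by
  refine (((integrable_gauss ht).comp_sub_left x).mul_const N).mono'
    ((((continuous_gauss t).comp (by fun_prop)).mul hu).aestronglyMeasurable)
    (Eventually.of_forall fun ξ => ?_)
  rw [norm_mul, Real.norm_of_nonneg (gauss_nonneg _ _)]
  exact mul_le_mul_of_nonneg_left (hN ξ) (gauss_nonneg _ _)

theorem initialPart_of_pos {γ t : ℝ} (ht : 0 < t) (u : ℝ → ℝ) (x : ℝ) :
    initialPart γ u t x = Real.exp (-γ * t) * ∫ ξ, gauss t (x - ξ) * u ξ := by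
  simp [initialPart, ht.ne', heatKernel_eq_gauss]

theorem initialPart_zero (γ : ℝ) (u : ℝ → ℝ) (x : ℝ) : initialPart γ u 0 x = u x := by
  simp [initialPart]

theorem gauss_sqrt_mul {t : ℝ} (ht : 0 < t) (z : ℝ) : √t * gauss t (√t * z) = gauss 1 z := by
  have hpi := Real.pi_pos
  unfold gauss
  rw [mul_pow, Real.sq_sqrt ht.le, Real.sqrt_mul (by positivity) t, mul_one, mul_one,
    show -(t * z ^ 2) / (4 * t) = -z ^ 2 / 4 by field_simp]
  field_simp

/-- The substitution `ξ = x - √t z` replaces the singular kernel by a fixed one and includes `t =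
0`, so dominated convergence gives continuity down to the initial time. -/
theorem initialPart_eq {γ t : ℝ} (ht : 0 ≤ t) (u : ℝ → ℝ) (x : ℝ) :
    initialPart γ u t x = Real.exp (-γ * t) * ∫ z, gauss 1 z * u (x - √t * z) := by
  rcases ht.eq_or_lt with rfl | ht
  · simp [initialPart_zero, integral_mul_const, integral_gauss one_pos]
  · rw [initialPart_of_pos ht]
    congr 1
    have h1 := integral_sub_left_eq_self (fun y => gauss t y * u (x - y)) volume x
    simp only [sub_sub_cancel] at h1
    rw [h1]
    have h2 := Measure.integral_comp_mul_left (fun y => gauss t y * u (x - y)) (√t)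
    have hs : 0 < √t := Real.sqrt_pos.2 ht
    rw [abs_of_pos (inv_pos.2 hs), smul_eq_mul, inv_mul_eq_div, eq_div_iff hs.ne'] at h2
    rw [← h2, ← integral_mul_const]
    refine integral_congr_ae (Eventually.of_forall fun z => ?_)
    simp only
    rw [← gauss_sqrt_mul ht z]
    ring

theorem continuous_initialPart {X : Type*} [TopologicalSpace X] [FirstCountableTopology X]
    {γ N : ℝ} {u : ℝ → ℝ} (hu : Continuous u) (hN : ∀ x, |u x| ≤ N) {f y : X → ℝ}
    (hf : Continuous f) (hf0 : ∀ p, 0 ≤ f p) (hy : Continuous y) :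
    Continuous fun p => initialPart γ u (f p) (y p) := by
  simp_rw [fun p => initialPart_eq (γ := γ) (hf0 p) u (y p)]
  refine Continuous.mul (by fun_prop) ?_
  refine continuous_of_dominated (bound := fun z => gauss 1 z * N) (fun p => ?_) (fun p => ?_)
    ((integrable_gauss one_pos).mul_const N) (Eventually.of_forall fun z => ?_)
  · exact ((continuous_gauss 1).mul (hu.comp (by fun_prop))).aestronglyMeasurable
  · refine Eventually.of_forall fun z => ?_
    rw [norm_mul, Real.norm_of_nonneg (gauss_nonneg _ _)]
    exact mul_le_mul_of_nonneg_left (hN _) (gauss_nonneg _ _)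
  · exact continuous_const.mul (hu.comp (by fun_prop))

theorem abs_initialPart_le {γ t N : ℝ} (ht : 0 ≤ t) {u : ℝ → ℝ} (hN : ∀ x, |u x| ≤ N) (x : ℝ) :
    |initialPart γ u t x| ≤ Real.exp (-γ * t) * N := by
  rw [initialPart_eq ht, abs_mul, abs_of_pos (Real.exp_pos _)]
  gcongr
  have h := norm_integral_le_of_norm_le (f := fun z => gauss 1 z * u (x - √t * z))
    ((integrable_gauss one_pos).mul_const N) (Eventually.of_forall fun z => by
      rw [norm_mul, Real.norm_of_nonneg (gauss_nonneg _ _)]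
      exact mul_le_mul_of_nonneg_left (hN _) (gauss_nonneg _ _))
  rwa [integral_mul_const, integral_gauss one_pos, one_mul] at h

theorem initialPart_nonneg {γ t : ℝ} (ht : 0 ≤ t) {u : ℝ → ℝ} (h : ∀ x, 0 ≤ u x) (x : ℝ) :
    0 ≤ initialPart γ u t x := by
  rw [initialPart_eq ht]
  exact mul_nonneg (Real.exp_pos _).le
    (integral_nonneg fun z => mul_nonneg (gauss_nonneg _ _) (h _))

theorem initialPart_sub {γ t N M : ℝ} (ht : 0 ≤ t) {u w : ℝ → ℝ} (hu : Continuous u)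
    (hw : Continuous w) (hN : ∀ x, |u x| ≤ N) (hM : ∀ x, |w x| ≤ M) (x : ℝ) :
    initialPart γ u t x - initialPart γ w t x = initialPart γ (fun y => u y - w y) t x := by
  rcases ht.eq_or_lt with rfl | ht
  · simp [initialPart_zero]
  · rw [initialPart_of_pos ht, initialPart_of_pos ht, initialPart_of_pos ht, ← mul_sub,
      ← integral_sub (integrable_gauss_mul ht hu hN x) (integrable_gauss_mul ht hw hM x)]
    simp_rw [mul_sub]

theorem initialPart_comp_add_right (γ t c : ℝ) (u : ℝ → ℝ) (x : ℝ) :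
    initialPart γ (fun y => u (y + c)) t x = initialPart γ u t (x + c) := by
  unfold initialPart
  split_ifs
  · rfl
  · congr 1
    rw [← integral_add_right_eq_self (fun ξ => heatKernel (x + c) t ξ 0 * u ξ) c]
    simp [heatKernel_eq_gauss]

theorem initialPart_add {γ a b N : ℝ} (ha : 0 ≤ a) (hb : 0 ≤ b) {u : ℝ → ℝ} (hu : Continuous u)
    (hN : ∀ x, |u x| ≤ N) (x : ℝ) :
    initialPart γ (initialPart γ u a) b x = initialPart γ u (a + b) x := by
  rcases ha.eq_or_lt with rfl | ha
  · rw [zero_add]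
    congr 1
    ext y
    exact initialPart_zero γ u y
  rcases hb.eq_or_lt with rfl | hb
  · rw [add_zero, initialPart_zero]
  rw [initialPart_of_pos hb, initialPart_of_pos (add_pos ha hb)]
  simp_rw [initialPart_of_pos ha]
  have h := integral_gauss_mul_superposition (μ := volume) hb (ρ := fun _ => a) (p := id) (h := u)
    (Eventually.of_forall fun _ => ha) measurable_const measurable_id hu.measurable x
    (integrable_gauss_mul (add_pos hb ha) hu hN x)
  simp only [id] at h
  rw [add_comm a b, ← h]
  simp_rw [mul_left_comm _ (Real.exp _) _]
  rw [integral_const_mul, ← mul_assoc, ← Real.exp_add]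
  ring_nf

/-- The triangle inequality moves the weight from `y` to `x`; the price `e^{α|x-y|}` is paid by
Gaussian moments or by the bound on the front. -/
theorem exp_neg_mul_abs_le {α : ℝ} (hα : 0 ≤ α) (x y : ℝ) :
    Real.exp (-α * |y|) ≤ Real.exp (-α * |x|) * Real.exp (α * |x - y|) := by
  rw [← Real.exp_add, Real.exp_le_exp]
  have h : |x| ≤ |y| + |x - y| := by
    have := abs_add_le y (x - y); simpa using this
  nlinarith

theorem integrable_gauss_mul_exp_neg_abs {α t : ℝ} (hα : 0 ≤ α) (ht : 0 < t) (x : ℝ) :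
    Integrable (fun ξ => gauss t (x - ξ) * Real.exp (-α * |ξ|)) :=
  integrable_gauss_mul ht (N := 1) (by fun_prop) (fun ξ => by
    rw [Real.abs_exp, Real.exp_le_one_iff]
    nlinarith [abs_nonneg ξ]) x

theorem integral_gauss_mul_exp_neg_abs_le {α t : ℝ} (hα : 0 ≤ α) (ht : 0 < t) (x : ℝ) :
    ∫ ξ, gauss t (x - ξ) * Real.exp (-α * |ξ|) ≤
      2 * Real.exp (α ^ 2 * t) * Real.exp (-α * |x|) := by
  calc ∫ ξ, gauss t (x - ξ) * Real.exp (-α * |ξ|)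
      ≤ ∫ ξ, (gauss t (x - ξ) * Real.exp (α * |x - ξ|)) * Real.exp (-α * |x|) := by
        refine integral_mono (integrable_gauss_mul_exp_neg_abs hα ht x)
          (((integrable_gauss_mul_exp_abs ht α).comp_sub_left x).mul_const _) fun ξ => ?_
        simp only
        rw [mul_assoc, mul_comm (Real.exp (α * |x - ξ|))]
        exact mul_le_mul_of_nonneg_left (exp_neg_mul_abs_le hα x ξ) (gauss_nonneg _ _)
    _ = (∫ y, gauss t y * Real.exp (α * |y|)) * Real.exp (-α * |x|) := by
        rw [integral_mul_const,
          integral_sub_left_eq_self (fun y => gauss t y * Real.exp (α * |y|)) volume x]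
    _ ≤ _ := by gcongr; exact integral_gauss_mul_exp_abs_le ht α

theorem abs_initialPart_le_exp {γ α t N : ℝ} (hα : 0 ≤ α) (ht : 0 ≤ t) {u : ℝ → ℝ}
    (hN : ∀ x, |u x| ≤ N * Real.exp (-α * |x|)) (x : ℝ) :
    |initialPart γ u t x| ≤ 2 * N * Real.exp ((α ^ 2 - γ) * t) * Real.exp (-α * |x|) := by
  have hN0 : 0 ≤ N := by
    have := (abs_nonneg _).trans (hN 0); simpa using this
  rcases ht.eq_or_lt with rfl | ht
  · rw [initialPart_zero, mul_zero, Real.exp_zero, mul_one]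
    refine (hN x).trans ?_
    gcongr
    linarith
  · rw [initialPart_of_pos ht, abs_mul, abs_of_pos (Real.exp_pos _)]
    have h := norm_integral_le_of_norm_le (f := fun ξ => gauss t (x - ξ) * u ξ)
      ((integrable_gauss_mul_exp_neg_abs hα ht x).const_mul N) (Eventually.of_forall fun ξ => by
        rw [norm_mul, Real.norm_of_nonneg (gauss_nonneg _ _), mul_left_comm]
        exact mul_le_mul_of_nonneg_left (hN _) (gauss_nonneg _ _))
    rw [integral_const_mul, Real.norm_eq_abs] at h
    have h2 := mul_le_mul_of_nonneg_left (integral_gauss_mul_exp_neg_abs_le hα ht x) hN0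
    calc _ ≤ Real.exp (-γ * t) * (N * (2 * Real.exp (α ^ 2 * t) * Real.exp (-α * |x|))) := by
          gcongr; exact h.trans h2
      _ = 2 * N * (Real.exp (-γ * t) * Real.exp (α ^ 2 * t)) * Real.exp (-α * |x|) := by ring
      _ = _ := by rw [← Real.exp_add]; ring_nf

/-- The smoothing loss `1/√t` will be compensated by front displacements that differ by `O(√t)`. -/
theorem abs_initialPart_sub_le {γ α t N : ℝ} (hγ : 0 ≤ γ) (hα : 0 ≤ α) (ht : 0 < t) {u : ℝ → ℝ}
    (hu : Continuous u) (hN : ∀ x, |u x| ≤ N * Real.exp (-α * |x|)) (x y : ℝ) :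
    |initialPart γ u t x - initialPart γ u t y| ≤
      |x - y| / √t * (N * (2 * Real.exp (α ^ 2 * (2 * t)) *
        (Real.exp (-α * |x|) + Real.exp (-α * |y|)))) := by
  have hN0 : 0 ≤ N := by
    have := (abs_nonneg _).trans (hN 0); simpa using this
  have hN' : ∀ x, |u x| ≤ N := fun x => (hN x).trans (by
    refine mul_le_of_le_one_right hN0 ?_
    rw [Real.exp_le_one_iff]
    nlinarith [abs_nonneg x])
  rw [initialPart_of_pos ht, initialPart_of_pos ht, ← mul_sub, abs_mul,
    abs_of_pos (Real.exp_pos _),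
    ← integral_sub (integrable_gauss_mul ht hu hN' x) (integrable_gauss_mul ht hu hN' y)]
  have h2t : 0 < 2 * t := by positivity
  have ix := integrable_gauss_mul_exp_neg_abs hα h2t x
  have iy := integrable_gauss_mul_exp_neg_abs hα h2t y
  have h := norm_integral_le_of_norm_le
    (f := fun ξ => gauss t (x - ξ) * u ξ - gauss t (y - ξ) * u ξ)
    ((ix.add iy).const_mul (|x - y| / √t * N)) (Eventually.of_forall fun ξ => by
      rw [← sub_mul, norm_mul]
      have h1 := abs_gauss_sub_le_mul ht (x - ξ) (y - ξ)
      rw [sub_sub_sub_cancel_right] at h1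
      calc ‖gauss t (x - ξ) - gauss t (y - ξ)‖ * ‖u ξ‖
          ≤ (|x - y| / √t * (gauss (2 * t) (x - ξ) + gauss (2 * t) (y - ξ))) *
              (N * Real.exp (-α * |ξ|)) := by
            have := gauss_nonneg (2 * t) (x - ξ)
            have := gauss_nonneg (2 * t) (y - ξ)
            exact mul_le_mul h1 (hN ξ) (norm_nonneg _) (by positivity)
        _ = _ := by simp only [Pi.add_apply]; ring)
  rw [integral_const_mul] at h
  simp only [Pi.add_apply] at h
  rw [integral_add ix iy] at h
  have hx := integral_gauss_mul_exp_neg_abs_le hα h2t x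
  have hy := integral_gauss_mul_exp_neg_abs_le hα h2t y
  have h3 : Real.exp (-γ * t) ≤ 1 := by rw [Real.exp_le_one_iff]; nlinarith
  refine (mul_le_of_le_one_left (abs_nonneg _) h3).trans (h.trans ?_)
  rw [mul_assoc]
  gcongr
  linarith

/-! ### The front -/

theorem front_zero (v : ℝ → ℝ) : front v 0 = 0 := by simp [front]

theorem front_congr {v w : ℝ → ℝ} (h : EqOn v w (Ici 0)) {t : ℝ} (ht : 0 ≤ t) :
    front v t = front w t :=
  intervalIntegral.integral_congr fun τ hτ => h (by rw [uIcc_of_le ht] at hτ; exact hτ.1)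

theorem interfacePart_congr {γ : ℝ} {v w : ℝ → ℝ} (h : EqOn v w (Ici 0)) {t : ℝ} (ht : 0 ≤ t)
    (x : ℝ) : interfacePart γ v t x = interfacePart γ w t x := by
  unfold interfacePart
  congr 1
  refine intervalIntegral.integral_congr fun τ hτ => ?_
  rw [uIcc_of_le ht] at hτ
  rw [h hτ.1, front_congr h hτ.1]

section Potential

variable {γ V : ℝ} {v : ℝ → ℝ}

theorem front_sub (hv : Continuous v) (a t : ℝ) : front v t - front v a = ∫ τ in a..t, v τ :=
  intervalIntegral.integral_interval_sub_left (hv.intervalIntegrable _ _)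
    (hv.intervalIntegrable _ _)

theorem continuous_front (hv : Continuous v) : Continuous (front v) :=
  intervalIntegral.continuous_primitive (fun _ _ => hv.intervalIntegrable _ _) 0

theorem abs_front_sub_le (hv : Continuous v) (hb : ∀ t, |v t| ≤ V) (a t : ℝ) :
    |front v t - front v a| ≤ V * |t - a| := by
  rw [front_sub hv]
  exact intervalIntegral.norm_integral_le_of_norm_le_const (f := v) fun τ _ => hb τ

theorem front_comp_add_left (hv : Continuous v) (a t : ℝ) :
    front (fun τ => v (a + τ)) t = front v (a + t) - front v a := by
  rw [front_sub hv, front, intervalIntegral.integral_comp_add_left, add_zero]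

/-! ### The potential of the interface -/

/-- In the age variable `r = t - τ` of the emitted heat the singularity sits at `r = 0` for every
`t`. -/
theorem interfacePart_eq (γ : ℝ) (v : ℝ → ℝ) (t x : ℝ) :
    interfacePart γ v t x =
      ∫ r in 0..t, Real.exp (-γ * r) * gauss r (x - front v (t - r)) * -v (t - r) := by
  have h := intervalIntegral.integral_comp_sub_left (a := 0) (b := t)
    (fun r => Real.exp (-γ * r) * gauss r (x - front v (t - r)) * -v (t - r)) t
  simp only [sub_sub_cancel, sub_self, sub_zero] at h
  rw [← h, interfacePart, ← intervalIntegral.integral_neg]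
  simp [heatKernel_eq_gauss]

theorem abs_exp_mul_gauss_mul_le {r y h : ℝ} (hr : 0 ≤ r) (hh : |h| ≤ V) :
    |Real.exp (-γ * r) * gauss r y * h| ≤ timeKernel γ r * V := by
  rw [abs_mul, abs_of_nonneg (mul_nonneg (Real.exp_pos _).le (gauss_nonneg _ _))]
  refine mul_le_mul ?_ hh (abs_nonneg _) (timeKernel_nonneg _ _)
  have := mul_le_mul_of_nonneg_left (gauss_le hr y) (Real.exp_pos (-γ * r)).le
  rwa [mul_one_div] at this

theorem measurable_layer {p h : ℝ → ℝ} (hp : Measurable p) (hh : Measurable h) :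
    Measurable fun r => Real.exp (-γ * r) * gauss r (p r) * h r :=
  ((by fun_prop : Measurable fun r : ℝ => Real.exp (-γ * r)).mul
    (measurable_gauss measurable_id hp)).mul hh

theorem integrableOn_layer (hγ : 0 < γ) {p h : ℝ → ℝ} (hp : Measurable p) (hh : Measurable h)
    (hV : ∀ r, |h r| ≤ V) :
    IntegrableOn (fun r => Real.exp (-γ * r) * gauss r (p r) * h r) (Ioi 0) := by
  refine ((integrableOn_timeKernel hγ).mul_const V).mono'
    (measurable_layer hp hh).aestronglyMeasurable ?_
  exact (ae_restrict_iff' measurableSet_Ioi).2 (Eventually.of_forall fun r hr =>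
    abs_exp_mul_gauss_mul_le (mem_Ioi.1 hr).le (hV r))

theorem intervalIntegrable_layer (hγ : 0 < γ) {p h : ℝ → ℝ} (hp : Measurable p)
    (hh : Measurable h) (hV : ∀ r, |h r| ≤ V) {t : ℝ} (ht : 0 ≤ t) :
    IntervalIntegrable (fun r => Real.exp (-γ * r) * gauss r (p r) * h r) volume 0 t :=
  (intervalIntegrable_iff_integrableOn_Ioc_of_le ht).2
    ((integrableOn_layer hγ hp hh hV).mono_set Ioc_subset_Ioi_self)

theorem abs_intervalIntegral_le_of_le_timeKernel (hγ : 0 < γ) {t C : ℝ} (ht : 0 ≤ t) (hC : 0 ≤ C)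
    {f : ℝ → ℝ} (hf : ∀ r, 0 < r → r ≤ t → |f r| ≤ timeKernel γ r * C) :
    |∫ r in 0..t, f r| ≤ C / (2 * √γ) := by
  rw [intervalIntegral.integral_of_le ht]
  have hi : IntegrableOn (fun r => timeKernel γ r * C) (Ioi 0) :=
    (integrableOn_timeKernel hγ).mul_const C
  calc |∫ r in Ioc 0 t, f r| ≤ ∫ r in Ioc 0 t, timeKernel γ r * C :=
        norm_integral_le_of_norm_le (f := f) (hi.mono_set Ioc_subset_Ioi_self)
          ((ae_restrict_iff' measurableSet_Ioc).2 (Eventually.of_forall fun r hr => hf r hr.1 hr.2))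
    _ ≤ ∫ r in Ioi 0, timeKernel γ r * C :=
        setIntegral_mono_set hi (Eventually.of_forall fun r => mul_nonneg (timeKernel_nonneg _ _) hC)
          (Eventually.of_forall Ioc_subset_Ioi_self)
    _ = C / (2 * √γ) := by rw [integral_mul_const, integral_timeKernel hγ]; ring

theorem abs_interfacePart_le (hγ : 0 < γ) (hb : ∀ t, |v t| ≤ V) {t : ℝ} (ht : 0 ≤ t) (x : ℝ) :
    |interfacePart γ v t x| ≤ V / (2 * √γ) := by
  rw [interfacePart_eq]
  exact abs_intervalIntegral_le_of_le_timeKernel hγ ht ((abs_nonneg _).trans (hb 0)) fun r hr _ =>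
    abs_exp_mul_gauss_mul_le hr.le (by rw [abs_neg]; exact hb _)

theorem interfacePart_nonneg (hv0 : ∀ t, v t ≤ 0) {t : ℝ} (ht : 0 ≤ t) (x : ℝ) :
    0 ≤ interfacePart γ v t x := by
  rw [interfacePart_eq]
  exact intervalIntegral.integral_nonneg ht fun r _ => mul_nonneg
    (mul_nonneg (Real.exp_pos _).le (gauss_nonneg _ _)) (neg_nonneg.2 (hv0 _))

theorem interfacePart_zero (γ : ℝ) (v : ℝ → ℝ) (x : ℝ) : interfacePart γ v 0 x = 0 := by
  simp [interfacePart]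

theorem continuous_interfacePart {X : Type*} [TopologicalSpace X] [FirstCountableTopology X]
    (hγ : 0 < γ) (hv : Continuous v) (hb : ∀ t, |v t| ≤ V) {f y : X → ℝ}
    (hf : Continuous f) (hf0 : ∀ p, 0 ≤ f p) (hy : Continuous y) :
    Continuous fun p => interfacePart γ v (f p) (y p) := by
  -- An indicator absorbs the moving endpoint, leaving a fixed domain on which `timeKernel`
  -- dominates.
  have e : ∀ p, interfacePart γ v (f p) (y p) = ∫ r in Ioi 0, (Ioc 0 (f p)).indicator
      (fun r => Real.exp (-γ * r) * gauss r (y p - front v (f p - r)) * -v (f p - r)) r := by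
    intro p
    rw [interfacePart_eq, intervalIntegral.integral_of_le (hf0 p),
      setIntegral_indicator measurableSet_Ioc, inter_eq_right.2 Ioc_subset_Ioi_self]
  simp_rw [e]
  have hfr := continuous_front hv
  rw [continuous_iff_continuousAt]
  intro p₀
  refine continuousAt_of_dominated (bound := fun r => timeKernel γ r * V)
    (Eventually.of_forall fun p => ?_) (Eventually.of_forall fun p => ?_)
    ((integrableOn_timeKernel hγ).mul_const V) ?_
  · refine ((measurable_layer ?_ ?_).indicator measurableSet_Ioc).aestronglyMeasurable
    · exact (continuous_const.sub (hfr.comp (by fun_prop))).measurable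
    · exact (hv.comp (by fun_prop : Continuous fun r => f p - r)).neg.measurable
  · refine (ae_restrict_iff' measurableSet_Ioi).2 (Eventually.of_forall fun r hr => ?_)
    rw [mem_Ioi] at hr
    refine (norm_indicator_le_norm_self _ _).trans (abs_exp_mul_gauss_mul_le hr.le ?_)
    rw [abs_neg]; exact hb _
  · refine (ae_restrict_iff' measurableSet_Ioi).2 ?_
    -- The integrand jumps in `p` only at the age `r = f p₀`, a null set.
    have hne : ∀ᵐ r : ℝ, r ≠ f p₀ := by
      simp [ae_iff, measure_singleton]
    filter_upwards [hne] with r hne hr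
    rcases hne.lt_or_gt with hlt | hgt
    · have hc : Continuous fun p =>
          Real.exp (-γ * r) * gauss r (y p - front v (f p - r)) * -v (f p - r) :=
        (continuous_const.mul ((continuous_gauss r).comp
          (hy.sub (hfr.comp (hf.sub continuous_const))))).mul
          (hv.comp (hf.sub continuous_const)).neg
      refine hc.continuousAt.congr ?_
      filter_upwards [hf.continuousAt.eventually (lt_mem_nhds hlt)] with p hp
      rw [indicator_of_mem (show r ∈ Ioc 0 (f p) from ⟨hr, hp.le⟩)]
    · refine (continuousAt_const (y := (0 : ℝ))).congr ?_
      filter_upwards [hf.continuousAt.eventually (gt_mem_nhds hgt)] with p hp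
      rw [indicator_of_notMem (show r ∉ Ioc 0 (f p) from fun h => absurd h.2 (not_le.2 hp))]

/-- The ages are cut at `b`. Younger heat was emitted after time `a` and is the potential of the
shifted velocity; older heat is, by Chapman–Kolmogorov, the potential at time `a` carried along by
the damped heat flow. -/
theorem interfacePart_add (hγ : 0 < γ) (hv : Continuous v) (hb : ∀ t, |v t| ≤ V) {a b : ℝ}
    (ha : 0 ≤ a) (hb0 : 0 ≤ b) (x : ℝ) :
    interfacePart γ v (a + b) x = initialPart γ (interfacePart γ v a) b x +
      interfacePart γ (fun τ => v (a + τ)) b (x - front v a) := by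
  have hfr := continuous_front hv
  rcases hb0.eq_or_lt with rfl | hb0
  · rw [initialPart_zero, interfacePart_zero, add_zero, add_zero]
  have hVn : ∀ r, |-v (a + b - r)| ≤ V := fun r => by rw [abs_neg]; exact hb _
  have hm1 : Measurable fun r => x - front v (a + b - r) :=
    (continuous_const.sub (hfr.comp (by fun_prop))).measurable
  have hm2 : Measurable fun r => -v (a + b - r) :=
    (hv.comp (by fun_prop : Continuous fun r => a + b - r)).neg.measurable
  have hi := integrableOn_layer hγ hm1 hm2 hVn
  have hib : IntervalIntegrable (fun r => Real.exp (-γ * r) *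
      gauss r (x - front v (a + b - r)) * -v (a + b - r)) volume 0 b :=
    intervalIntegrable_layer hγ hm1 hm2 hVn hb0.le
  have hiab : IntervalIntegrable (fun r => Real.exp (-γ * r) *
      gauss r (x - front v (a + b - r)) * -v (a + b - r)) volume b (b + a) :=
    (intervalIntegrable_iff_integrableOn_Ioc_of_le (by linarith)).2
      (hi.mono_set fun r hr => hb0.trans hr.1)
  rw [interfacePart_eq γ v (a + b) x, add_comm a b, add_comm b a,
    show (a + b : ℝ) = b + a from add_comm a b] at *
  rw [← intervalIntegral.integral_add_adjacent_intervals hib hiab, add_comm (∫ r in 0..b, _)]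
  congr 1
  · rw [initialPart_of_pos hb0]
    have hsh := intervalIntegral.integral_comp_add_left (a := 0) (b := a) (fun r =>
      Real.exp (-γ * r) * gauss r (x - front v (b + a - r)) * -v (b + a - r)) b
    rw [add_zero] at hsh
    rw [← hsh]
    simp only [add_sub_add_left_eq_sub]
    have h := integral_gauss_mul_superposition (μ := volume.restrict (Ioc 0 a)) hb0
      (ρ := fun r => r) (p := fun r => front v (a - r))
      (h := fun r => Real.exp (-γ * r) * -v (a - r))
      ((ae_restrict_iff' measurableSet_Ioc).2 (Eventually.of_forall fun r hr => hr.1))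
      measurable_id (hfr.comp (by fun_prop)).measurable
      (Continuous.mul (by fun_prop)
        (hv.comp (by fun_prop : Continuous fun r => a - r)).neg).measurable x ?_
    · rw [intervalIntegral.integral_of_le ha]
      have e1 : ∀ r, Real.exp (-γ * (b + r)) * gauss (b + r) (x - front v (a - r)) * -v (a - r) =
          Real.exp (-γ * b) *
            (gauss (b + r) (x - front v (a - r)) * (Real.exp (-γ * r) * -v (a - r))) := by
        intro r
        rw [mul_add, Real.exp_add]; ring
      simp_rw [e1]
      rw [integral_const_mul, ← h]
      congr 2
      ext ξ
      rw [interfacePart_eq, intervalIntegral.integral_of_le ha]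
      congr 2
      ext r
      ring
    -- The integrability required for the superposition is that of the older ages, up to the factor
    -- `e^{γb}`.
    · have := hiab.comp_add_left b
      rw [sub_self, add_sub_cancel_left, intervalIntegrable_iff_integrableOn_Ioc_of_le ha] at this
      have h2 := this.const_mul (Real.exp (γ * b))
      refine h2.congr (Eventually.of_forall fun r => ?_)
      simp only [add_sub_add_left_eq_sub]
      have e2 : Real.exp (γ * b) * Real.exp (-γ * (b + r)) = Real.exp (-γ * r) := by
        rw [← Real.exp_add]; ring_nf
      rw [← e2]; ring
  · rw [interfacePart_eq]
    refine intervalIntegral.integral_congr fun r _ => ?_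
    rw [front_comp_add_left hv, show b + a - r = a + (b - r) by ring]
    ring_nf

end Potential

section Decay

variable {γ V : ℝ} {v : ℝ → ℝ}

/-! ### Equicontinuity of the potential of the interface -/

/-- Interpolation between the bounds of order `r^{-1/2}` and `|y-z|/r`. A full Lipschitz bound would
have a nonintegrable singularity; the exponent `1/2` leaves `r^{-3/4}`. -/
theorem abs_gauss_sub_le_sqrt {r : ℝ} (hr : 0 < r) (y z : ℝ) :
    |gauss r y - gauss r z| ≤ √|y - z| * r ^ (-(3 / 4) : ℝ) := by
  have hpi : 3 < Real.pi := Real.pi_gt_three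
  have h1 := abs_gauss_sub_le hr y z
  have h2 : |gauss r y - gauss r z| ≤ 1 / Real.sqrt (4 * Real.pi * r) := by
    rw [abs_le]
    constructor <;> linarith [gauss_le hr.le y, gauss_le hr.le z, gauss_nonneg r y, gauss_nonneg r z]
  have hsr : 0 < √r := Real.sqrt_pos.2 hr
  have h3 : |gauss r y - gauss r z| ≤ √(|y - z| / √r) / √r := by
    have h4 : √r ≤ √(4 * Real.pi * r) := Real.sqrt_le_sqrt (by nlinarith)
    rcases le_total 1 (|y - z| / √r) with h | h
    · refine h2.trans ?_
      gcongr
      exact Real.one_le_sqrt.2 h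
    · refine h1.trans ?_
      have h5 : |y - z| / √r ≤ √(|y - z| / √r) := by
        apply Real.le_sqrt_of_sq_le
        nlinarith [show 0 ≤ |y - z| / √r by positivity]
      have h6 : |y - z| / (2 * √r) ≤ |y - z| / √r := by
        gcongr
        linarith
      gcongr
      exact h6.trans h5
  refine h3.trans (le_of_eq ?_)
  rw [Real.sqrt_div (abs_nonneg _), Real.sqrt_eq_rpow r, Real.sqrt_eq_rpow (r ^ _), ← Real.rpow_mul hr.le,
    div_div, ← Real.rpow_add hr, div_eq_mul_inv, ← Real.rpow_neg hr.le]
  norm_num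

theorem abs_interfacePart_sub_le (hγ : 0 < γ) (hv : Continuous v) (hb : ∀ t, |v t| ≤ V) {t : ℝ}
    (ht : 0 ≤ t) (x y : ℝ) :
    |interfacePart γ v t x - interfacePart γ v t y| ≤
      (V * ∫ r in Ioi (0 : ℝ), r ^ (-(3 / 4) : ℝ) * Real.exp (-γ * r)) * √|x - y| := by
  have hV0 : 0 ≤ V := (abs_nonneg _).trans (hb 0)
  have hfr := continuous_front hv
  have hVn : ∀ r, |-v (t - r)| ≤ V := fun r => by rw [abs_neg]; exact hb _
  have hm : ∀ x, Measurable fun r => x - front v (t - r) := fun x =>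
    (continuous_const.sub (hfr.comp (by fun_prop))).measurable
  have hm2 : Measurable fun r => -v (t - r) :=
    (hv.comp (by fun_prop : Continuous fun r => t - r)).neg.measurable
  have hi : IntegrableOn (fun r : ℝ => r ^ (-(3 / 4) : ℝ) * Real.exp (-γ * r)) (Ioi 0) := by
    have := integrableOn_rpow_mul_exp_neg_mul_rpow (p := 1) (s := (-(3 / 4) : ℝ)) (b := γ)
      (by norm_num) (by norm_num) hγ
    simpa using this
  have hi' : IntegrableOn
      (fun r : ℝ => V * √|x - y| * (r ^ (-(3 / 4) : ℝ) * Real.exp (-γ * r))) (Ioi 0) :=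
    hi.const_mul _
  rw [interfacePart_eq, interfacePart_eq, ← intervalIntegral.integral_sub
    (intervalIntegrable_layer hγ (hm x) hm2 hVn ht) (intervalIntegrable_layer hγ (hm y) hm2 hVn ht),
    intervalIntegral.integral_of_le ht]
  refine (norm_integral_le_of_norm_le (G := ℝ) (hi'.mono_set Ioc_subset_Ioi_self)
    ((ae_restrict_iff' measurableSet_Ioc).2 (Eventually.of_forall fun r hr => ?_))).trans ?_
  · rw [← sub_mul, ← mul_sub, norm_mul, norm_mul, Real.norm_of_nonneg (Real.exp_pos _).le]
    have h1 := abs_gauss_sub_le_sqrt hr.1 (x - front v (t - r)) (y - front v (t - r))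
    rw [sub_sub_sub_cancel_right] at h1
    have h0 : 0 ≤ r ^ (-(3 / 4) : ℝ) := Real.rpow_nonneg hr.1.le _
    calc _ ≤ Real.exp (-γ * r) * (√|x - y| * r ^ (-(3 / 4) : ℝ)) * V := by
          gcongr
          · exact h1
          · exact hVn r
      _ = _ := by ring
  · refine (setIntegral_mono_set hi' ((ae_restrict_iff' measurableSet_Ioi).2
      (Eventually.of_forall fun r hr => ?_)) (Eventually.of_forall Ioc_subset_Ioi_self)).trans
      (le_of_eq ?_)
    · have h0 : 0 ≤ r ^ (-(3 / 4) : ℝ) := Real.rpow_nonneg (mem_Ioi.1 hr).le _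
      simp only [Pi.zero_apply]
      positivity
    · rw [integral_const_mul]; ring

/-! ### Exponential decay of the potential of the interface -/

/-- Away from the interface, the contribution of a short time interval is of higher order. -/
theorem abs_interfacePart_le_of_le_abs {α δ h : ℝ} (hγ : 0 < γ) (hv : Continuous v)
    (hb : ∀ t, |v t| ≤ V) (hδ : 0 < δ) (hh : 0 ≤ h) (hh1 : h ≤ 1) (hVh : 2 * V * h ≤ δ) {y : ℝ}
    (hy : δ ≤ |y|) :
    |interfacePart γ v h (y + front v h)| ≤
      V * (Real.exp (8 * α ^ 2) * (32 / δ ^ 2)) * √h * h * Real.exp (-α * |y|) := by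
  have hV0 : 0 ≤ V := (abs_nonneg _).trans (hb 0)
  rw [interfacePart_eq]
  have key : ∀ r ∈ uIoc 0 h,
      ‖Real.exp (-γ * r) * gauss r (y + front v h - front v (h - r)) * -v (h - r)‖ ≤
        V * (Real.exp (8 * α ^ 2) * (32 / δ ^ 2)) * √h * Real.exp (-α * |y|) := by
    intro r hr
    rw [uIoc_of_le hh] at hr
    obtain ⟨hr0, hrh⟩ := hr
    have hpi : 3 < Real.pi := Real.pi_gt_three
    set d := front v h - front v (h - r) with hd
    have hd1 : |d| ≤ V * r := by
      have := abs_front_sub_le hv hb (h - r) h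
      rwa [sub_sub_cancel, abs_of_pos hr0] at this
    -- Within the step the front moves by at most `V h ≤ δ/2`, so the source stays at distance at
    -- least `|y|/2`.
    have hd2 : |d| ≤ |y| / 2 := by nlinarith
    have hz : |y| / 2 ≤ |y + d| := by
      have := abs_sub_abs_le_abs_sub y (-d)
      rw [abs_neg, sub_neg_eq_add] at this
      linarith
    have hz2 : y ^ 2 / 4 ≤ (y + d) ^ 2 := by
      have := pow_le_pow_left₀ (by positivity) hz 2
      rw [sq_abs, div_pow, sq_abs] at this
      linarith
    have hexp : Real.exp (-(y + d) ^ 2 / (4 * r)) ≤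
        Real.exp (8 * α ^ 2) * (32 / δ ^ 2 * r) * Real.exp (-α * |y|) := by
      -- The exponent `-y²/(16r)` is halved: one half absorbs `e^{α|y|}` by completing the square,
      -- the other, with `|y| ≥ δ`, leaves `e^{-δ²/(32r)}`, which is at most `32r/δ²` and so gains a
      -- power of `r`.
      have h1 : -(y + d) ^ 2 / (4 * r) ≤ 8 * α ^ 2 + -(δ ^ 2 / (32 * r)) + -α * |y| := by
        have e1 : -(y + d) ^ 2 / (4 * r) ≤ -(|y| ^ 2 / 4) / (4 * r) := by
          rw [sq_abs]
          gcongr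
        have e2 : -(|y| ^ 2 / 4) / (4 * r) =
            8 * α ^ 2 * r + -(|y| ^ 2 / (32 * r)) + -α * |y| - (|y| - 16 * α * r) ^ 2 / (32 * r) := by
          field_simp
          ring
        have e3 : 0 ≤ (|y| - 16 * α * r) ^ 2 / (32 * r) := by positivity
        have e4 : δ ^ 2 / (32 * r) ≤ |y| ^ 2 / (32 * r) := by gcongr
        have e5 : 8 * α ^ 2 * r ≤ 8 * α ^ 2 := by nlinarith [sq_nonneg α]
        linarith
      refine (Real.exp_le_exp.2 h1).trans ?_
      rw [Real.exp_add, Real.exp_add]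
      gcongr
      rw [Real.exp_neg, inv_le_comm₀ (Real.exp_pos _) (by positivity)]
      have := Real.add_one_le_exp (δ ^ 2 / (32 * r))
      have e : (32 / δ ^ 2 * r)⁻¹ = δ ^ 2 / (32 * r) := by
        field_simp
      rw [e]
      linarith
    have hsr : 0 < √r := Real.sqrt_pos.2 hr0
    have hs : r / √(4 * Real.pi * r) ≤ √h := by
      have h4 : √r ≤ √(4 * Real.pi * r) := Real.sqrt_le_sqrt (by nlinarith)
      calc r / √(4 * Real.pi * r) ≤ r / √r := by gcongr
        _ = √r := Real.div_sqrt
        _ ≤ √h := Real.sqrt_le_sqrt hrh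
    rw [norm_mul, norm_mul, Real.norm_of_nonneg (Real.exp_pos _).le,
      Real.norm_of_nonneg (gauss_nonneg _ _), norm_neg]
    have h3 : Real.exp (-γ * r) ≤ 1 := by rw [Real.exp_le_one_iff]; nlinarith
    have hg : gauss r (y + front v h - front v (h - r)) ≤
        Real.exp (8 * α ^ 2) * (32 / δ ^ 2) * √h * Real.exp (-α * |y|) := by
      rw [add_sub_assoc, ← hd]
      unfold gauss
      calc _ ≤ Real.exp (8 * α ^ 2) * (32 / δ ^ 2 * r) * Real.exp (-α * |y|) /
            √(4 * Real.pi * r) := by gcongr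
        _ = Real.exp (8 * α ^ 2) * (32 / δ ^ 2) * (r / √(4 * Real.pi * r)) *
            Real.exp (-α * |y|) := by ring
        _ ≤ _ := by gcongr
    calc _ ≤ 1 * (Real.exp (8 * α ^ 2) * (32 / δ ^ 2) * √h * Real.exp (-α * |y|)) * V := by
          have h0 := gauss_nonneg r (y + front v h - front v (h - r))
          exact mul_le_mul (mul_le_mul h3 hg h0 zero_le_one) (hb _) (norm_nonneg _)
            (mul_nonneg zero_le_one (h0.trans hg))
      _ = _ := by ring
  refine (intervalIntegral.norm_integral_le_of_norm_le_const key).trans (le_of_eq ?_)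
  rw [sub_zero, abs_of_nonneg hh]
  ring

/-- Heat flow of an exponential. -/
theorem initialPart_le_exp_of_le {β c M h : ℝ} (hh : 0 < h) {u : ℝ → ℝ} (hu : Continuous u)
    {N : ℝ} (hN : ∀ x, |u x| ≤ N) (hM : ∀ x, u x ≤ M * Real.exp (-β * (x - c))) (x : ℝ) :
    initialPart γ u h x ≤ M * Real.exp ((β ^ 2 - γ) * h) * Real.exp (-β * (x - c)) := by
  have e : ∀ ξ, gauss h (x - ξ) * (M * Real.exp (-β * (ξ - c))) =
      M * Real.exp (-β * (x - c)) * (gauss h (x - ξ) * Real.exp (β * (x - ξ))) := by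
    intro ξ
    rw [show -β * (ξ - c) = -β * (x - c) + β * (x - ξ) by ring, Real.exp_add]; ring
  have hi := ((integrable_gauss_mul_exp hh β).comp_sub_left x).const_mul
    (M * Real.exp (-β * (x - c)))
  rw [initialPart_of_pos hh]
  calc _ ≤ Real.exp (-γ * h) * ∫ ξ, M * Real.exp (-β * (x - c)) *
          (gauss h (x - ξ) * Real.exp (β * (x - ξ))) := by
        refine mul_le_mul_of_nonneg_left ?_ (Real.exp_pos _).le
        refine integral_mono (integrable_gauss_mul hh hu hN x) hi fun ξ => ?_
        simp only
        rw [← e]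
        exact mul_le_mul_of_nonneg_left (hM ξ) (gauss_nonneg _ _)
    _ = M * (Real.exp (-γ * h) * Real.exp (β ^ 2 * h)) * Real.exp (-β * (x - c)) := by
        rw [integral_const_mul,
          integral_sub_left_eq_self (fun y => gauss h y * Real.exp (β * y)) volume x,
          integral_gauss_mul_exp hh]
        ring
    _ = _ := by rw [← Real.exp_add]; ring_nf

/-- One time step of the comparison with an exponential. -/
theorem interfacePart_add_le_exp {α δ σ a h : ℝ} (hγ : 0 < γ) (hV : 0 < V) (hv : Continuous v)
    (hb : ∀ t, |v t| ≤ V) (hα : 0 ≤ α) (hσ : |σ| = 1)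
    (hδ : 0 < δ) (hαδ : α * δ ≤ 1 / 2) (ha : 0 ≤ a) (hh : 0 < h) (hh1 : h ≤ 1)
    (hVh : 2 * V * h ≤ δ)
    (hsmall : Real.exp (8 * α ^ 2) * (32 / δ ^ 2) * √h * h ≤
      (1 - Real.exp (-(γ - α ^ 2 - α * V) * h)) / √γ)
    (hM : ∀ x, interfacePart γ v a x ≤ V / √γ * Real.exp (-(α * σ) * (x - front v a))) (x : ℝ) :
    interfacePart γ v (a + h) x ≤ V / √γ * Real.exp (-(α * σ) * (x - front v (a + h))) := by
  have hsγ : 0 < √γ := Real.sqrt_pos.2 hγ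
  set y := x - front v (a + h) with hy
  -- Where `σy ≤ δ`, the condition `αδ ≤ 1/2` keeps the barrier above half its amplitude, and the
  -- uniform bound `V/(2√γ)` suffices.
  rcases le_or_gt (σ * y) δ with hle | hlt
  · have h1 := (le_abs_self _).trans (abs_interfacePart_le hγ hb (add_nonneg ha hh.le) x)
    have h2 : 1 / 2 ≤ Real.exp (-(α * σ) * y) := by
      have := Real.add_one_le_exp (-(α * σ) * y)
      nlinarith
    calc _ ≤ V / (2 * √γ) := h1
      _ = V / √γ * (1 / 2) := by field_simp
      _ ≤ _ := by gcongr
  · have hYy : σ * y = |y| := by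
      rw [← abs_of_pos (hδ.trans hlt), abs_mul, hσ, one_mul]
    have hw : Continuous fun τ => v (a + τ) := hv.comp (by fun_prop)
    have hU : Continuous (interfacePart γ v a) :=
      continuous_interfacePart hγ hv hb continuous_const (fun _ => ha) continuous_id
    have hsrc := (le_abs_self _).trans (abs_interfacePart_le_of_le_abs (α := α) hγ hw
      (fun t => hb _) hδ hh.le hh1 hVh (hYy ▸ hlt.le))
    have hxe : y + front (fun τ => v (a + τ)) h = x - front v a := by
      rw [front_comp_add_left hv]; ring
    rw [hxe] at hsrc
    have hini := initialPart_le_exp_of_le (γ := γ) hh hU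
      (fun x => abs_interfacePart_le hγ hb ha x) hM x
    rw [interfacePart_add hγ hv hb ha hh.le]
    have hσ2 : σ ^ 2 = 1 := by rw [← sq_abs, hσ, one_pow]
    -- Spreading contributes `e^{α²h}`, absorption `e^{-γh}`, and recentring the barrier at the new
    -- front at most `e^{αVh}`: together `e^{-κh}`.
    have hexp : Real.exp (((α * σ) ^ 2 - γ) * h) * Real.exp (-(α * σ) * (x - front v a)) ≤
        Real.exp (-(γ - α ^ 2 - α * V) * h) * Real.exp (-α * |y|) := by
      rw [← Real.exp_add, ← Real.exp_add, Real.exp_le_exp, mul_pow, hσ2]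
      have h1 := abs_front_sub_le hv hb a (a + h)
      rw [add_sub_cancel_left, abs_of_pos hh] at h1
      have h2 : -(σ * (front v (a + h) - front v a)) ≤ V * h := by
        refine (neg_le_abs _).trans ?_
        rw [abs_mul, hσ, one_mul]; exact h1
      have h3 := mul_le_mul_of_nonneg_left h2 hα
      have h4 : -(α * σ) * (x - front v a) =
          -α * |y| + α * -(σ * (front v (a + h) - front v a)) := by
        rw [← hYy, hy]; ring
      rw [h4]
      linarith
    have e5 : -(α * σ) * y = -α * |y| := by rw [← hYy]; ring
    rw [e5]
    -- The source is paid for by the part `1 - e^{-κh}` of the barrier that the contraction frees.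
    have h6 := mul_le_mul_of_nonneg_left hsmall (mul_nonneg hV.le (Real.exp_pos (-α * |y|)).le)
    have h7 := mul_le_mul_of_nonneg_left hexp (show 0 ≤ V / √γ by positivity)
    have e8 : V * Real.exp (-α * |y|) * ((1 - Real.exp (-(γ - α ^ 2 - α * V) * h)) / √γ) =
        V / √γ * Real.exp (-α * |y|) -
          V / √γ * (Real.exp (-(γ - α ^ 2 - α * V) * h) * Real.exp (-α * |y|)) := by
      field_simp
    rw [e8] at h6
    linarith

/-- The source is of order `h^{3/2}` while the freed part of the barrier is linear in `h`. -/
theorem exists_small_step {α κ δ V γ : ℝ} (hκ : 0 < κ) (hδ : 0 < δ) (hV : 0 < V) (hγ : 0 < γ) :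
    ∃ h₀ > 0, ∀ h, 0 < h → h ≤ h₀ → h ≤ 1 ∧ 2 * V * h ≤ δ ∧
      Real.exp (8 * α ^ 2) * (32 / δ ^ 2) * √h * h ≤ (1 - Real.exp (-κ * h)) / √γ := by
  set E := Real.exp (8 * α ^ 2) * (32 / δ ^ 2) with hE
  have hE0 : 0 < E := by positivity
  have hsγ : 0 < √γ := Real.sqrt_pos.2 hγ
  set q := κ / (2 * √γ * E) with hq
  have hq0 : 0 < q := by positivity
  -- The bound `h ≤ 1/κ` yields `e^{-κh} ≤ 1 - κh/2`, and `h ≤ q²` makes the source at most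
  -- `κh/(2√γ)`.
  refine ⟨min (min 1 (δ / (2 * V))) (min (1 / κ) (q ^ 2)), by positivity, fun h hh hle => ?_⟩
  simp only [le_min_iff] at hle
  obtain ⟨⟨h1, h2⟩, h3, h4⟩ := hle
  refine ⟨h1, ?_, ?_⟩
  · rw [le_div_iff₀ (by positivity)] at h2
    linarith
  · rw [le_div_iff₀ hκ] at h3
    have hs : √h ≤ q := Real.sqrt_le_iff.2 ⟨hq0.le, h4⟩
    have hexp : Real.exp (-κ * h) ≤ 1 - κ * h / 2 := by
      have h5 := Real.add_one_le_exp (κ * h)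
      rw [neg_mul, Real.exp_neg, inv_le_comm₀ (Real.exp_pos _) (by nlinarith)]
      refine le_trans ?_ h5
      rw [inv_le_iff_one_le_mul₀ (by nlinarith)]
      have : 0 < κ * h := by positivity
      nlinarith
    rw [le_div_iff₀ hsγ]
    calc E * √h * h * √γ ≤ E * q * h * √γ := by gcongr
      _ = κ * h / 2 := by rw [hq]; field_simp
      _ ≤ _ := by linarith

/-- Induction over `n` equal steps; the constant is the same at every step, hence uniform in `t`.
The one-sided exponential (`σ = ±1`) is an exact eigenfunction of heat flow, whereas estimating the
flow of `e^{-α|x|}` would lose a factor at each step. -/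
theorem interfacePart_le_exp {α σ : ℝ} (hγ : 0 < γ) (hV : 0 < V) (hv : Continuous v)
    (hb : ∀ t, |v t| ≤ V) (hα : 0 ≤ α) (hκ : 0 < γ - α ^ 2 - α * V) (hσ : |σ| = 1) {t : ℝ}
    (ht : 0 ≤ t) (x : ℝ) :
    interfacePart γ v t x ≤ V / √γ * Real.exp (-(α * σ) * (x - front v t)) := by
  -- The width `δ = 1/(2(α+1))` ensures `αδ ≤ 1/2`, also for `α = 0`.
  have hδ : 0 < 1 / (2 * (α + 1)) := by positivity
  have hαδ : α * (1 / (2 * (α + 1))) ≤ 1 / 2 := by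
    rw [mul_one_div, div_le_div_iff₀ (by positivity) (by positivity)]
    linarith
  obtain ⟨h₀, hh₀, hstep⟩ := exists_small_step (α := α) hκ hδ hV hγ
  have hzero : ∀ x, interfacePart γ v 0 x ≤ V / √γ * Real.exp (-(α * σ) * (x - front v 0)) := by
    intro x
    rw [interfacePart_zero]
    positivity
  rcases ht.eq_or_lt with rfl | ht
  · exact hzero x
  obtain ⟨n, hn⟩ := exists_nat_gt (t / h₀)
  have hn0 : (0 : ℝ) < n := lt_trans (by positivity) hn
  have hh : 0 < t / n := by positivity
  have hle : t / n ≤ h₀ := by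
    rw [div_lt_iff₀ hh₀] at hn
    rw [div_le_iff₀ hn0]
    linarith
  obtain ⟨h1, h2, h3⟩ := hstep _ hh hle
  have main : ∀ k : ℕ, ∀ x, interfacePart γ v (k * (t / n)) x ≤
      V / √γ * Real.exp (-(α * σ) * (x - front v (k * (t / n)))) := by
    intro k
    induction k with
    | zero => simpa using hzero
    | succ k ih =>
      have e : ((k + 1 : ℕ) : ℝ) * (t / n) = k * (t / n) + t / n := by push_cast; ring
      rw [e]
      exact interfacePart_add_le_exp hγ hV hv hb hα hσ hδ hαδ (by positivity) hh h1 h2 h3 ih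
  have := main n x
  rwa [mul_div_cancel₀ _ hn0.ne'] at this

theorem interfacePart_le_exp_abs {α : ℝ} (hγ : 0 < γ) (hV : 0 < V) (hv : Continuous v)
    (hb : ∀ t, |v t| ≤ V) (hα : 0 ≤ α) (hκ : 0 < γ - α ^ 2 - α * V) {t : ℝ}
    (ht : 0 ≤ t) (x : ℝ) :
    interfacePart γ v t (x + front v t) ≤ V / √γ * Real.exp (-α * |x|) := by
  rcases abs_cases x with ⟨h, _⟩ | ⟨h, _⟩
  · have := interfacePart_le_exp hγ hV hv hb hα hκ (σ := 1) (by simp) ht (x + front v t)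
    rw [add_sub_cancel_right, mul_one] at this
    rwa [h]
  · have := interfacePart_le_exp hγ hV hv hb hα hκ (σ := -1) (by simp) ht (x + front v t)
    rw [add_sub_cancel_right] at this
    rw [h]
    convert this using 3
    ring

end Decay

/-! ### The weighted spaces -/

namespace WeightedC

variable {α : ℝ}

theorem add_apply (u w : WeightedC α) (x : ℝ) : (u + w) x = u x + w x := rfl

theorem sub_apply (u w : WeightedC α) (x : ℝ) : (u - w) x = u x - w x := rfl

theorem smul_apply (c : ℝ) (u : WeightedC α) (x : ℝ) : (c • u) x = c * u x := rfl

theorem continuous (u : WeightedC α) : Continuous u := u.2.1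

theorem abs_apply_le (u : WeightedC α) (x : ℝ) : |u x| ≤ ‖u‖ * Real.exp (-α * |x|) := by
  have h : Real.exp (α * |x|) * |u x| ≤ ‖u‖ := le_ciSup u.bddAbove x
  rw [neg_mul, Real.exp_neg, ← div_eq_mul_inv, le_div_iff₀ (Real.exp_pos _), mul_comm]
  exact h

theorem exp_mul_abs_le_of_le {a C x : ℝ} (h : |a| ≤ C * Real.exp (-α * |x|)) :
    Real.exp (α * |x|) * |a| ≤ C := by
  rwa [neg_mul, Real.exp_neg, ← div_eq_mul_inv, le_div_iff₀ (Real.exp_pos _), mul_comm] at h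

theorem norm_le_of_forall {u : WeightedC α} {C : ℝ}
    (h : ∀ x, |u x| ≤ C * Real.exp (-α * |x|)) : ‖u‖ ≤ C :=
  ciSup_le fun x => exp_mul_abs_le_of_le (h x)

theorem abs_apply_le_norm (hα : 0 ≤ α) (u : WeightedC α) (x : ℝ) : |u x| ≤ ‖u‖ :=
  (u.abs_apply_le x).trans (mul_le_of_le_one_right (norm_nonneg _)
    (Real.exp_le_one_iff.2 (by nlinarith [abs_nonneg x])))

theorem mem_weightedSubmodule {f : ℝ → ℝ} {C : ℝ} (hf : Continuous f)
    (h : ∀ x, |f x| ≤ C * Real.exp (-α * |x|)) : f ∈ weightedSubmodule α :=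
  ⟨hf, C, by rintro _ ⟨x, rfl⟩; exact exp_mul_abs_le_of_le (h x)⟩

theorem ofFun_apply {f : ℝ → ℝ} (hf : f ∈ weightedSubmodule α) (x : ℝ) : ofFun α f x = f x := by
  have h : ofFun α f = (⟨f, hf⟩ : weightedSubmodule α) := dif_pos hf
  rw [h]

theorem ext {u w : WeightedC α} (h : ∀ x, u x = w x) : u = w := Subtype.ext (funext h)

noncomputable instance : NormedSpace ℝ (WeightedC α) where
  norm_smul_le c u := norm_le_of_forall fun x => by
    rw [smul_apply, abs_mul, mul_assoc]
    exact mul_le_mul_of_nonneg_left (u.abs_apply_le x) (abs_nonneg c)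

theorem continuous_apply (x : ℝ) : Continuous fun u : WeightedC α => u x := by
  refine continuous_iff_continuousAt.2 fun u => ?_
  refine tendsto_iff_dist_tendsto_zero.2 ?_
  have h : Tendsto (fun w : WeightedC α => ‖w - u‖ * Real.exp (-α * |x|)) (𝓝 u) (𝓝 0) := by
    have : Continuous fun w : WeightedC α => ‖w - u‖ * Real.exp (-α * |x|) := by fun_prop
    simpa using this.tendsto u
  exact squeeze_zero (fun _ => dist_nonneg) (fun w => (w - u).abs_apply_le x) h

end WeightedC

theorem isClosed_phaseSpace {J : Set ℝ} (hJ : IsClosed J) (α : ℝ) : IsClosed (phaseSpace J α) := by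
  have : phaseSpace J α = ⋂ x : ℝ, (fun u : WeightedC α => u x) ⁻¹' J := by
    ext u; simp [phaseSpace]
  rw [this]
  exact isClosed_iInter fun x => hJ.preimage (WeightedC.continuous_apply x)

theorem convex_ball {J : Set ℝ} (hJ : Convex ℝ J) (α r : ℝ) : Convex ℝ (ball J α r) := by
  intro u hu w hw a b ha hb hab
  refine ⟨fun x => ?_, ?_⟩
  · have := hJ (hu.1 x) (hw.1 x) ha hb hab
    simpa [WeightedC.add_apply, WeightedC.smul_apply] using this
  · calc ‖a • u + b • w‖ ≤ a * ‖u‖ + b * ‖w‖ := by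
          refine (norm_add_le _ _).trans (le_of_eq ?_)
          rw [norm_smul, norm_smul, Real.norm_of_nonneg ha, Real.norm_of_nonneg hb]
      _ ≤ a * r + b * r := by gcongr; exacts [hu.2, hw.2]
      _ = r := by rw [← add_mul, hab, one_mul]

/-! ### Compactness in the weighted spaces -/

/-- The functions with a given exponential decay and a given modulus of continuity. -/
def decayClass (β C H : ℝ) : Set (ℝ → ℝ) :=
  {f | (∀ x, |f x| ≤ C * Real.exp (-β * |x|)) ∧ ∀ x y, |f x - f y| ≤ H * √|x - y|}

/-- Compactness for pointwise convergence: a closed subset of a product of compact intervals, by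
Tychonoff. -/
theorem isCompact_decayClass (β C H : ℝ) : IsCompact (decayClass β C H) := by
  have hc : IsCompact (univ.pi fun x : ℝ =>
      Icc (-(C * Real.exp (-β * |x|))) (C * Real.exp (-β * |x|))) :=
    isCompact_univ_pi fun _ => isCompact_Icc
  refine hc.of_isClosed_subset ?_ fun f hf x _ => abs_le.1 (hf.1 x)
  have : decayClass β C H = (⋂ x : ℝ, {f | |f x| ≤ C * Real.exp (-β * |x|)}) ∩
      ⋂ x : ℝ, ⋂ y : ℝ, {f | |f x - f y| ≤ H * √|x - y|} := by
    ext f; simp [decayClass]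
  rw [this]
  refine (isClosed_iInter fun x => isClosed_le (by fun_prop) continuous_const).inter
    (isClosed_iInter fun x => isClosed_iInter fun y =>
      isClosed_le (by fun_prop) continuous_const)

theorem continuous_of_mem_decayClass {β C H : ℝ} {f : ℝ → ℝ} (hf : f ∈ decayClass β C H) :
    Continuous f := by
  refine continuous_iff_continuousAt.2 fun x => tendsto_iff_dist_tendsto_zero.2 ?_
  have hc : Continuous fun y => H * √|y - x| := by fun_prop
  have h : Tendsto (fun y => H * √|y - x|) (𝓝 x) (𝓝 0) := by
    simpa using hc.tendsto x
  exact squeeze_zero (fun _ => dist_nonneg) (fun y => hf.2 y x) h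

theorem nonneg_of_mem_decayClass {β C H : ℝ} {f : ℝ → ℝ} (hf : f ∈ decayClass β C H) : 0 ≤ C := by
  have := (abs_nonneg _).trans (hf.1 0)
  simpa using this

theorem decayClass_subset_weightedSubmodule {α β C H : ℝ} (hαβ : α ≤ β) :
    decayClass β C H ⊆ weightedSubmodule α := fun f hf =>
  WeightedC.mem_weightedSubmodule (C := C) (continuous_of_mem_decayClass hf) fun x => by
    refine (hf.1 x).trans (mul_le_mul_of_nonneg_left ?_ (nonneg_of_mem_decayClass hf))
    rw [Real.exp_le_exp]
    nlinarith [abs_nonneg x]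

/-- On the classes of uniformly decaying and equicontinuous functions the topology of pointwise
convergence is finer than that of the weighted norm. -/
theorem continuousOn_ofFun_decayClass {α β : ℝ} (hα : 0 ≤ α) (hαβ : α < β) (C H : ℝ) :
    ContinuousOn (WeightedC.ofFun α) (decayClass β C H) := by
  intro f hf
  have hC := nonneg_of_mem_decayClass hf
  refine Metric.tendsto_nhds.2 fun ε hε => ?_
  -- Beyond `R` the surplus decay `β - α` makes the weighted difference small without using
  -- closeness.
  obtain ⟨R, hR0, hR⟩ : ∃ R : ℝ, 0 ≤ R ∧ ∀ x, R ≤ x → 2 * C * Real.exp (-(β - α) * x) ≤ ε / 2 := by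
    have h1 : Tendsto (fun x : ℝ => 2 * C * Real.exp (-((β - α) * x))) atTop (𝓝 (2 * C * 0)) :=
      (Real.tendsto_exp_neg_atTop_nhds_zero.comp
        (tendsto_id.const_mul_atTop (sub_pos.2 hαβ))).const_mul _
    rw [mul_zero] at h1
    obtain ⟨R, hR⟩ := eventually_atTop.1 (h1.eventually (ge_mem_nhds (half_pos hε)))
    refine ⟨max R 0, le_max_right _ _, fun x hx => ?_⟩
    rw [neg_mul]
    exact hR x ((le_max_left _ _).trans hx)
  -- On `[-R, R]` the weight is at most `e^{αR}`, so unweighted closeness `η` is enough there; it is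
  -- split in three between the two moduli of continuity and a finite `ρ`-net.
  set η := ε / 2 * Real.exp (-α * R) with hη
  have hη0 : 0 < η := by positivity
  obtain ⟨ρ, hρ0, hρ⟩ : ∃ ρ > 0, ∀ z : ℝ, |z| < ρ → H * √|z| ≤ η / 3 := by
    have hc : Continuous fun z : ℝ => H * √|z| := by fun_prop
    have h : Tendsto (fun z : ℝ => H * √|z|) (𝓝 0) (𝓝 0) := by simpa using hc.tendsto 0
    obtain ⟨ρ, hρ0, hρ⟩ := Metric.eventually_nhds_iff.1
      (h.eventually (ge_mem_nhds (show (0 : ℝ) < η / 3 by positivity)))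
    exact ⟨ρ, hρ0, fun z hz => hρ (by simpa using hz)⟩
  obtain ⟨F, -, hF, hcov⟩ := (isCompact_Icc (a := -R) (b := R)).finite_cover_balls hρ0
  have hev : ∀ᶠ q in 𝓝[decayClass β C H] f, ∀ p ∈ F, |q p - f p| < η / 3 := by
    refine nhdsWithin_le_nhds ((eventually_all_finite hF).2 fun p _ => ?_)
    have hc : Continuous fun q : ℝ → ℝ => |q p - f p| := by fun_prop
    have h : Tendsto (fun q : ℝ → ℝ => |q p - f p|) (𝓝 f) (𝓝 0) := by simpa using hc.tendsto f
    exact h.eventually (gt_mem_nhds (by positivity))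
  filter_upwards [hev, self_mem_nhdsWithin] with q hq hqm
  refine lt_of_le_of_lt ?_ (half_lt_self hε)
  rw [dist_eq_norm]
  refine WeightedC.norm_le_of_forall fun x => ?_
  rw [WeightedC.sub_apply, WeightedC.ofFun_apply (decayClass_subset_weightedSubmodule hαβ.le hqm),
    WeightedC.ofFun_apply (decayClass_subset_weightedSubmodule hαβ.le hf)]
  rcases le_total R |x| with h | h
  · calc |q x - f x| ≤ |q x| + |f x| := abs_sub _ _
      _ ≤ 2 * C * Real.exp (-β * |x|) := by linarith [hqm.1 x, hf.1 x]
      _ = 2 * C * Real.exp (-(β - α) * |x|) * Real.exp (-α * |x|) := by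
        rw [mul_assoc _ (Real.exp _), ← Real.exp_add]; ring_nf
      _ ≤ _ := by gcongr; exact hR _ h
  · have hx : x ∈ Icc (-R) R := abs_le.1 h
    obtain ⟨p, hp, hxp⟩ := mem_iUnion₂.1 (hcov hx)
    rw [Metric.mem_ball, Real.dist_eq] at hxp
    have h1 := (hqm.2 x p).trans (hρ _ hxp)
    have h2 := (hf.2 x p).trans (hρ _ hxp)
    have h3 := (hq p hp).le
    have h4 : |q x - f x| ≤ η := by
      rw [abs_le] at h1 h2 h3 ⊢
      constructor <;> linarith
    refine h4.trans ?_
    rw [hη]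
    gcongr ε / 2 * Real.exp ?_
    nlinarith

theorem isCompact_image_decayClass {α β : ℝ} (hα : 0 ≤ α) (hαβ : α < β) (C H : ℝ) :
    IsCompact (WeightedC.ofFun α '' decayClass β C H) :=
  (isCompact_decayClass β C H).image_of_continuousOn (continuousOn_ofFun_decayClass hα hαβ C H)

/-! ### Attractors of asymptotically compact semigroups -/

section Attractor

variable {E : Type*} [MetricSpace E] {S : ℝ → E → E} {P B K : Set E} {κ : ℝ}

theorem mem_omegaLimit_iff_exists_seq {a : E} :
    a ∈ omegaLimit atTop S B ↔ ∃ (t : ℕ → ℝ) (x : ℕ → E), Tendsto t atTop atTop ∧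
      (∀ n, x n ∈ B) ∧ Tendsto (fun n => S (t n) (x n)) atTop (𝓝 a) := by
  rw [mem_omegaLimit_iff_frequently]
  constructor
  · intro h
    have h1 : ∀ n : ℕ, ∃ t : ℝ, ∃ x ∈ B, (n : ℝ) ≤ t ∧ dist (S t x) a < 1 / (n + 1) := by
      intro n
      obtain ⟨t, hnt, x, hxB, hx⟩ := frequently_atTop.1
        (h (Metric.ball a (1 / (n + 1))) (Metric.ball_mem_nhds _ (by positivity))) n
      exact ⟨t, x, hxB, hnt, hx⟩
    choose t x hxB hnt hd using h1
    refine ⟨t, x, tendsto_atTop_mono hnt tendsto_natCast_atTop_atTop, hxB, ?_⟩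
    exact tendsto_iff_dist_tendsto_zero.2 (squeeze_zero (fun _ => dist_nonneg)
      (fun n => (hd n).le) tendsto_one_div_add_atTop_nhds_zero_nat)
  · rintro ⟨t, x, ht, hx, hlim⟩ n hn
    refine ht.frequently (Eventually.frequently ?_)
    filter_upwards [hlim.eventually hn] with k hk
    exact ⟨x k, hx k, hk⟩

/-- Asymptotic compactness: the nearby points of `K` have a convergent subsequence, and the
exponentially small distances transfer the limit. -/
theorem exists_subseq_tendsto_of_attractsExponentially (hκ : 0 < κ) (hK : IsCompact K)
    (hatt : AttractsExponentially S P K κ) {X : Set E} (hXP : X ⊆ P)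
    (hXb : Bornology.IsBounded X) {t : ℕ → ℝ} {x : ℕ → E} (ht : Tendsto t atTop atTop)
    (hx : ∀ n, x n ∈ X) :
    ∃ a ∈ K, ∃ φ : ℕ → ℕ, StrictMono φ ∧
      Tendsto (fun n => S (t (φ n)) (x (φ n))) atTop (𝓝 a) := by
  obtain ⟨C, hC⟩ := hatt X hXP hXb
  have h1 : ∀ n, ∃ k ∈ K, 0 ≤ t n → dist (S (t n) (x n)) k ≤ C * Real.exp (-κ * t n) := by
    intro n
    by_cases h : 0 ≤ t n
    · obtain ⟨k, hk, hd⟩ := hC (t n) h (x n) (hx n)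
      exact ⟨k, hk, fun _ => hd⟩
    -- Attraction says nothing at negative times; time `0` merely supplies some point of `K` for the
    -- finitely many such indices.
    · obtain ⟨k, hk, -⟩ := hC 0 le_rfl (x n) (hx n)
      exact ⟨k, hk, fun h' => absurd h' h⟩
  choose k hk hd using h1
  obtain ⟨a, ha, φ, hφ, hlim⟩ := hK.tendsto_subseq hk
  refine ⟨a, ha, φ, hφ, ?_⟩
  have htφ : Tendsto (fun n => t (φ n)) atTop atTop := ht.comp hφ.tendsto_atTop
  have h0 : Tendsto (fun n => C * Real.exp (-κ * t (φ n))) atTop (𝓝 0) := by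
    have := (Real.tendsto_exp_neg_atTop_nhds_zero.comp (htφ.const_mul_atTop hκ)).const_mul C
    simpa [Function.comp_def] using this
  have hdist : Tendsto (fun n => dist (S (t (φ n)) (x (φ n))) (k (φ n))) atTop (𝓝 0) := by
    refine squeeze_zero' (Eventually.of_forall fun _ => dist_nonneg) ?_ h0
    filter_upwards [htφ.eventually_ge_atTop 0] with n hn
    exact hd _ hn
  exact (tendsto_iff_of_dist hdist).2 hlim

/-- A point of an invariant set is `S(n) xₙ` for every `n`; this constant sequence must converge to
a point of `K`. -/
theorem subset_of_attractsExponentially (hκ : 0 < κ) (hK : IsCompact K)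
    (hatt : AttractsExponentially S P K κ) {X : Set E} (hXP : X ⊆ P)
    (hXb : Bornology.IsBounded X) (hinv : ∀ t : ℝ, 0 ≤ t → S t '' X = X) : X ⊆ K := by
  intro a ha
  have h1 : ∀ n : ℕ, ∃ x ∈ X, S n x = a := fun n => by
    rw [← hinv n n.cast_nonneg] at ha
    exact ha
  choose x hxX hx using h1
  obtain ⟨b, hb, φ, -, hlim⟩ := exists_subseq_tendsto_of_attractsExponentially hκ hK hatt hXP hXb
    tendsto_natCast_atTop_atTop hxX
  simp only [hx] at hlim
  rwa [tendsto_nhds_unique tendsto_const_nhds hlim]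

/-- Invariance puts `Y` into `B`, and preimages at all times `n` exhibit each of its points as an
omega-limit point. -/
theorem isMaximalInvariant_omegaLimit (habs : IsAbsorbing S P B) :
    IsMaximalInvariant S P (omegaLimit atTop S B) := by
  intro Y hYP hYb hinv y hy
  obtain ⟨t₁, ht₁, hB⟩ := habs Y hYP hYb
  have hYB : Y ⊆ B := by rw [← hinv t₁ ht₁]; exact hB t₁ le_rfl
  have h1 : ∀ n : ℕ, ∃ x ∈ Y, S n x = y := fun n => by
    rw [← hinv n n.cast_nonneg] at hy
    exact hy
  choose x hxY hx using h1
  exact mem_omegaLimit_iff_exists_seq.2 ⟨fun n => n, x, tendsto_natCast_atTop_atTop,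
    fun n => hYB (hxY n), by simp only [hx]; exact tendsto_const_nhds⟩

theorem isGlobalAttractor_omegaLimit (hκ : 0 < κ) (hPc : IsClosed P)
    (hmaps : ∀ t : ℝ, 0 ≤ t → MapsTo (S t) P P)
    (hadd : ∀ u ∈ P, ∀ t r : ℝ, 0 ≤ t → 0 ≤ r → S (t + r) u = S t (S r u))
    (hcont : ∀ t : ℝ, 0 ≤ t → ContinuousOn (S t) P) (hBP : B ⊆ P)
    (hBb : Bornology.IsBounded B) (habs : IsAbsorbing S P B) (hK : IsCompact K)
    (hatt : AttractsExponentially S P K κ) :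
    IsGlobalAttractor S P (omegaLimit atTop S B) := by
  have hsubK : omegaLimit atTop S B ⊆ K := by
    intro a ha
    obtain ⟨t, x, ht, hx, hlim⟩ := mem_omegaLimit_iff_exists_seq.1 ha
    obtain ⟨b, hb, φ, hφ, hlim'⟩ :=
      exists_subseq_tendsto_of_attractsExponentially hκ hK hatt hBP hBb ht hx
    rwa [tendsto_nhds_unique (hlim.comp hφ.tendsto_atTop) hlim']
  have hsubP : omegaLimit atTop S B ⊆ P := by
    intro a ha
    obtain ⟨t, x, ht, hx, hlim⟩ := mem_omegaLimit_iff_exists_seq.1 ha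
    refine hPc.mem_of_tendsto hlim ?_
    filter_upwards [ht.eventually_ge_atTop 0] with n hn
    exact hmaps _ hn (hBP (hx n))
  refine ⟨hsubP, hK.of_isClosed_subset (isClosed_omegaLimit _ _ _) hsubK, fun s hs => ?_,
    fun X hXP hXb δ hδ => ?_⟩
  · refine Subset.antisymm ?_ fun a ha => ?_
    · rintro _ ⟨a, ha, rfl⟩
      obtain ⟨t, x, ht, hx, hlim⟩ := mem_omegaLimit_iff_exists_seq.1 ha
      refine mem_omegaLimit_iff_exists_seq.2 ⟨fun n => s + t n, x,
        tendsto_atTop_add_const_left _ _ ht, hx, ?_⟩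
      have h1 : Tendsto (fun n => S (t n) (x n)) atTop (𝓝[P] a) :=
        tendsto_nhdsWithin_iff.2 ⟨hlim, by
          filter_upwards [ht.eventually_ge_atTop 0] with n hn
          exact hmaps _ hn (hBP (hx n))⟩
      refine ((hcont s hs a (hsubP ha)).tendsto.comp h1).congr' ?_
      filter_upwards [ht.eventually_ge_atTop 0] with n hn
      exact (hadd _ (hBP (hx n)) s (t n) hs hn).symm
    · obtain ⟨t, x, ht, hx, hlim⟩ := mem_omegaLimit_iff_exists_seq.1 ha
      -- A preimage of `a` under `S s` is a subsequential limit at the times `t n - s`; it exists by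
      -- asymptotic compactness.
      have ht' : Tendsto (fun n => t n - s) atTop atTop := tendsto_atTop_add_const_right _ _ ht
      obtain ⟨b, -, φ, hφ, hlim'⟩ :=
        exists_subseq_tendsto_of_attractsExponentially hκ hK hatt hBP hBb ht' hx
      have htφ := ht'.comp hφ.tendsto_atTop
      have hb : b ∈ omegaLimit atTop S B :=
        mem_omegaLimit_iff_exists_seq.2 ⟨_, fun n => x (φ n), htφ, fun n => hx _, hlim'⟩
      refine ⟨b, hb, ?_⟩
      have h1 : Tendsto (fun n => S (t (φ n) - s) (x (φ n))) atTop (𝓝[P] b) :=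
        tendsto_nhdsWithin_iff.2 ⟨hlim', by
          filter_upwards [htφ.eventually_ge_atTop 0] with n hn
          exact hmaps _ hn (hBP (hx _))⟩
      refine tendsto_nhds_unique ((hcont s hs b (hsubP hb)).tendsto.comp h1)
        ((hlim.comp hφ.tendsto_atTop).congr' ?_)
      filter_upwards [htφ.eventually_ge_atTop 0] with n hn
      have := hadd _ (hBP (hx (φ n))) s (t (φ n) - s) hs hn
      rw [add_sub_cancel] at this
      exact this
  · by_contra hcon
    push Not at hcon
    obtain ⟨t₁, ht₁, hB⟩ := habs X hXP hXb
    have h1 : ∀ n : ℕ, ∃ t : ℝ, ∃ x ∈ X, t₁ + n ≤ t ∧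
        S t x ∉ Metric.thickening δ (omegaLimit atTop S B) := by
      intro n
      obtain ⟨t, ht, hns⟩ := hcon (t₁ + n) (by positivity)
      obtain ⟨_, ⟨x, hx, rfl⟩, hxn⟩ := not_subset.1 hns
      exact ⟨t, x, hx, ht, hxn⟩
    choose t x hxX hnt hnot using h1
    -- Restarting at `t₁` puts the initial points into `B`, so any limit of the escaping sequence is
    -- an omega-limit point of `B`, a contradiction.
    have ht : Tendsto (fun n => t n - t₁) atTop atTop :=
      tendsto_atTop_mono (fun n => by linarith [hnt n]) tendsto_natCast_atTop_atTop
    have hxB : ∀ n, S t₁ (x n) ∈ B := fun n => hB t₁ le_rfl ⟨x n, hxX n, rfl⟩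
    obtain ⟨b, -, φ, hφ, hlim⟩ :=
      exists_subseq_tendsto_of_attractsExponentially hκ hK hatt hBP hBb ht hxB
    have hb : b ∈ omegaLimit atTop S B :=
      mem_omegaLimit_iff_exists_seq.2 ⟨_, _, ht.comp hφ.tendsto_atTop, fun n => hxB _, hlim⟩
    obtain ⟨n, hn⟩ := (hlim.eventually (Metric.ball_mem_nhds b hδ)).exists
    refine hnot (φ n) (Metric.mem_thickening_iff.2 ⟨b, hb, ?_⟩)
    have hnn : 0 ≤ t (φ n) - t₁ := by
      have := hnt (φ n)
      have h2 : (0 : ℝ) ≤ (φ n : ℕ) := Nat.cast_nonneg _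
      linarith
    have := hadd _ (hXP (hxX (φ n))) (t (φ n) - t₁) t₁ hnn ht₁
    rw [sub_add_cancel] at this
    rw [this]
    exact hn

/-- The connected set `S t '' B` contains `A = S t '' A` and, for large `t`, lies in any prescribed
neighbourhood of `A`; a separation of `A` would separate it. -/
theorem isConnected_omegaLimit (hκ : 0 < κ) (hcont : ∀ t : ℝ, 0 ≤ t → ContinuousOn (S t) P)
    (hBP : B ⊆ P) (hBb : Bornology.IsBounded B) (hBc : IsConnected B) (hK : IsCompact K)
    (hatt : AttractsExponentially S P K κ) (habs : IsAbsorbing S P B)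
    (hA : IsGlobalAttractor S P (omegaLimit atTop S B)) :
    IsConnected (omegaLimit atTop S B) := by
  set A := omegaLimit atTop S B with hAdef
  have hAB : A ⊆ B := by
    obtain ⟨t₁, ht₁, hB⟩ := habs A hA.subset hA.isCompact.isBounded
    rw [← hA.invariant t₁ ht₁]; exact hB t₁ le_rfl
  refine ⟨?_, ?_⟩
  · obtain ⟨x, hx⟩ := hBc.nonempty
    obtain ⟨b, -, φ, hφ, hlim⟩ := exists_subseq_tendsto_of_attractsExponentially hκ hK hatt hBP hBb
      (t := fun n => n) (x := fun _ => x) tendsto_natCast_atTop_atTop fun _ => hx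
    exact ⟨b, mem_omegaLimit_iff_exists_seq.2
      ⟨_, _, tendsto_natCast_atTop_atTop.comp hφ.tendsto_atTop, fun _ => hx, hlim⟩⟩
  · rw [isPreconnected_iff_subset_of_disjoint]
    intro U W hU hW hAUW hdisj
    -- `U` and `W` are disjoint only along `A`; they are replaced by truly disjoint open sets around
    -- the two compact pieces.
    have hcU : IsCompact (A \ W) := hA.isCompact.diff hW
    have hcW : IsCompact (A \ U) := hA.isCompact.diff hU
    have hdj : Disjoint (A \ W) (A \ U) := by
      rw [Set.disjoint_left]
      rintro a ⟨ha, haW⟩ ⟨-, haU⟩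
      rcases hAUW ha with h | h
      exacts [haU h, haW h]
    obtain ⟨U', W', hU', hW', hUU', hWW', hdisj'⟩ := SeparatedNhds.of_isCompact_isCompact hcU hcW hdj
    have hcov : A ⊆ U' ∪ W' := by
      intro a ha
      by_cases haW : a ∈ W
      · right
        refine hWW' ⟨ha, fun haU => ?_⟩
        have : a ∈ A ∩ (U ∩ W) := ⟨ha, haU, haW⟩
        rw [hdisj] at this
        exact this
      · exact Or.inl (hUU' ⟨ha, haW⟩)
    obtain ⟨δ', hδ', hthick'⟩ := hA.isCompact.exists_thickening_subset_open (hU'.union hW') hcov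
    obtain ⟨t, ht, hsub⟩ := hA.attracts B hBP hBb δ' hδ'
    have hconn : IsPreconnected (S t '' B) :=
      hBc.isPreconnected.image _ ((hcont t ht).mono hBP)
    have hAS : A ⊆ S t '' B := by
      conv_lhs => rw [← hA.invariant t ht]
      exact image_mono hAB
    have hcovB : S t '' B ⊆ U' ∪ W' := (hsub t le_rfl).trans hthick'
    rcases isPreconnected_iff_subset_of_disjoint.1 hconn U' W' hU' hW' hcovB
      (by rw [hdisj'.inter_eq, inter_empty]) with h | h
    · left
      intro a ha
      by_contra haU
      exact Set.disjoint_left.1 hdisj' (h (hAS ha)) (hWW' ⟨ha, haU⟩)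
    · right
      intro a ha
      by_contra haW
      exact Set.disjoint_left.1 hdisj' (hUU' ⟨ha, haW⟩) (h (hAS ha))

end Attractor

/-! ### The temperature as a function of the data and the velocity -/

theorem initialPart_fun_add {γ t N M : ℝ} (ht : 0 ≤ t) {u w : ℝ → ℝ} (hu : Continuous u)
    (hw : Continuous w) (hN : ∀ x, |u x| ≤ N) (hM : ∀ x, |w x| ≤ M) (x : ℝ) :
    initialPart γ (fun y => u y + w y) t x = initialPart γ u t x + initialPart γ w t x := by
  rcases ht.eq_or_lt with rfl | ht
  · simp [initialPart_zero]
  · rw [initialPart_of_pos ht, initialPart_of_pos ht, initialPart_of_pos ht, ← mul_add,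
      ← integral_add (integrable_gauss_mul ht hu hN x) (integrable_gauss_mul ht hw hM x)]
    simp_rw [mul_add]

theorem temperature_congr {γ : ℝ} (u : ℝ → ℝ) {v w : ℝ → ℝ} (h : EqOn v w (Ici 0)) {t : ℝ}
    (ht : 0 ≤ t) (x : ℝ) : temperature γ u v t x = temperature γ u w t x := by
  rw [temperature, temperature, interfacePart_congr h ht]

section Temperature

variable {γ N V lam D : ℝ} {u v w : ℝ → ℝ}

theorem continuous_temperature {X : Type*} [TopologicalSpace X] [FirstCountableTopology X]
    (hγ : 0 < γ) (hu : Continuous u) (hN : ∀ x, |u x| ≤ N) (hv : Continuous v)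
    (hb : ∀ t, |v t| ≤ V) {f y : X → ℝ} (hf : Continuous f) (hf0 : ∀ p, 0 ≤ f p)
    (hy : Continuous y) : Continuous fun p => temperature γ u v (f p) (y p) :=
  (continuous_initialPart hu hN hf hf0 hy).add (continuous_interfacePart hγ hv hb hf hf0 hy)

/-- The evolution restarted at time `a`, in the frame of the interface at that time. -/
theorem temperature_restart (hγ : 0 < γ) (hu : Continuous u) (hN : ∀ x, |u x| ≤ N)
    (hv : Continuous v) (hb : ∀ t, |v t| ≤ V) {a b : ℝ} (ha : 0 ≤ a) (hb0 : 0 ≤ b) (x : ℝ) :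
    temperature γ (fun y => temperature γ u v a (y + front v a)) (fun τ => v (a + τ)) b x =
      temperature γ u v (a + b) (x + front v a) := by
  have h1 : Continuous (initialPart γ u a) :=
    continuous_initialPart hu hN continuous_const (fun _ => ha) continuous_id
  have h2 : Continuous (interfacePart γ v a) :=
    continuous_interfacePart hγ hv hb continuous_const (fun _ => ha) continuous_id
  have h3 := interfacePart_add hγ hv hb ha hb0 (x + front v a)
  rw [add_sub_cancel_right] at h3
  rw [temperature, initialPart_comp_add_right γ b (front v a) (temperature γ u v a) x]
  have h4 := initialPart_fun_add (γ := γ) hb0 h1 h2 (fun x => abs_initialPart_le ha hN x)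
    (fun x => abs_interfacePart_le hγ hb ha x) (x + front v a)
  have h5 : temperature γ u v a = fun y => initialPart γ u a y + interfacePart γ v a y := rfl
  rw [h5, h4, initialPart_add ha hb0 hu hN, temperature, h3, add_assoc]

theorem one_sub_exp_neg_le_sqrt {x : ℝ} (hx : 0 ≤ x) : 1 - Real.exp (-x) ≤ √x := by
  rcases le_total x 1 with h | h
  · have h1 := Real.add_one_le_exp (-x)
    have h2 : x ≤ √x := Real.le_sqrt_of_sq_le (by nlinarith)
    linarith
  · have h1 : 1 ≤ √x := Real.one_le_sqrt.2 h
    linarith [Real.exp_pos (-x)]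

/-- The integral of `e^{λτ}` is bounded through `1 - e^{-x} ≤ √x`. The factor `√(b-a)` is there to
cancel the Lipschitz singularity of the kernel, and `1/√λ` remains as the small constant. -/
theorem abs_front_sub_front_le (hv : Continuous v) (hw : Continuous w) (hlam : 0 < lam)
    (hD : ∀ t, 0 ≤ t → |v t - w t| ≤ D * Real.exp (lam * t)) {a b : ℝ} (ha : 0 ≤ a)
    (hab : a ≤ b) :
    |(front v b - front v a) - (front w b - front w a)| ≤
      D * Real.exp (lam * b) * (√(b - a) / √lam) := by
  have hD0 : 0 ≤ D := by
    have := (abs_nonneg _).trans (hD 0 le_rfl); simpa using this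
  rw [front_sub hv, front_sub hw, ← intervalIntegral.integral_sub (hv.intervalIntegrable _ _)
    (hw.intervalIntegrable _ _)]
  have hi : IntervalIntegrable (fun τ => D * Real.exp (lam * τ)) volume a b :=
    Continuous.intervalIntegrable (by fun_prop) _ _
  have h1 : |∫ τ in a..b, (v τ - w τ)| ≤ ∫ τ in a..b, D * Real.exp (lam * τ) :=
    intervalIntegral.norm_integral_le_of_norm_le (f := fun τ => v τ - w τ) hab
      (Eventually.of_forall fun τ hτ => hD τ (ha.trans hτ.1.le)) hi
  refine h1.trans ?_
  rw [intervalIntegral.integral_const_mul, 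
    intervalIntegral.integral_comp_mul_left (fun x => Real.exp x) hlam.ne', integral_exp, smul_eq_mul,
    mul_assoc]
  refine mul_le_mul_of_nonneg_left ?_ hD0
  have h2 := one_sub_exp_neg_le_sqrt (x := lam * (b - a)) (mul_nonneg hlam.le (sub_nonneg.2 hab))
  have h3 : Real.exp (lam * a) = Real.exp (lam * b) * Real.exp (-(lam * (b - a))) := by
    rw [← Real.exp_add]; ring_nf
  have hs : √lam * √lam = lam := Real.mul_self_sqrt hlam.le
  have hs0 : 0 < √lam := Real.sqrt_pos.2 hlam
  rw [Real.sqrt_mul hlam.le] at h2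
  calc _ = Real.exp (lam * b) * ((1 - Real.exp (-(lam * (b - a)))) / lam) := by
        rw [h3]; ring
    _ ≤ Real.exp (lam * b) * (√lam * √(b - a) / lam) := by gcongr
    _ = _ := by
        congr 1
        rw [div_eq_div_iff hlam.ne' hs0.ne']
        rw [mul_right_comm, hs]; ring

/-- The difference is split into a change `e` of source strength and a change `q` of source
position. -/
theorem abs_interfacePart_moving_sub_le (hγ : 0 < γ) (hlam : 0 < lam) (hv : Continuous v)
    (hw : Continuous w) (hvb : ∀ t, |v t| ≤ V) (hwb : ∀ t, |w t| ≤ V)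
    (hD : ∀ t, 0 ≤ t → |v t - w t| ≤ D * Real.exp (lam * t)) {t : ℝ} (ht : 0 ≤ t) (x : ℝ) :
    |interfacePart γ v t (x + front v t) - interfacePart γ w t (x + front w t)| ≤
      D * Real.exp (lam * t) * ((1 / 2 + V / (4 * √γ)) / √lam) := by
  have hD0 : 0 ≤ D := by
    have := (abs_nonneg _).trans (hD 0 le_rfl); simpa using this
  have hV0 : 0 ≤ V := (abs_nonneg _).trans (hvb 0)
  have hs0 : 0 < √lam := Real.sqrt_pos.2 hlam
  have hsγ : 0 < √γ := Real.sqrt_pos.2 hγ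
  have hfv := continuous_front hv
  have hfw := continuous_front hw
  have hmv : Measurable fun r => x + front v t - front v (t - r) :=
    (continuous_const.sub (hfv.comp (by fun_prop))).measurable
  have hmw : Measurable fun r => x + front w t - front w (t - r) :=
    (continuous_const.sub (hfw.comp (by fun_prop))).measurable
  have hnv : Measurable fun r => -v (t - r) :=
    (hv.comp (by fun_prop : Continuous fun r => t - r)).neg.measurable
  have hnw : Measurable fun r => -w (t - r) :=
    (hw.comp (by fun_prop : Continuous fun r => t - r)).neg.measurable
  rw [interfacePart_eq, interfacePart_eq, ← intervalIntegral.integral_sub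
    (intervalIntegrable_layer hγ hmv hnv (fun r => by rw [abs_neg]; exact hvb _) ht)
    (intervalIntegrable_layer hγ hmw hnw (fun r => by rw [abs_neg]; exact hwb _) ht)]
  set e := fun r => Real.exp (-γ * r) * gauss r (x + front v t - front v (t - r)) *
    (w (t - r) - v (t - r)) with he
  set q := fun r => Real.exp (-γ * r) * (gauss r (x + front v t - front v (t - r)) -
    gauss r (x + front w t - front w (t - r))) * -w (t - r) with hq
  have hmdiff : Measurable fun r => w (t - r) - v (t - r) :=
    ((hw.comp (by fun_prop : Continuous fun r => t - r)).sub
      (hv.comp (by fun_prop : Continuous fun r => t - r))).measurable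
  have hie : IntervalIntegrable e volume 0 t :=
    intervalIntegrable_layer (V := V + V) hγ hmv hmdiff
      (fun r => (abs_sub _ _).trans (add_le_add (hwb _) (hvb _))) ht
  have hiq : IntervalIntegrable q volume 0 t := by
    have := (intervalIntegrable_layer hγ hmv hnw (fun r => by rw [abs_neg]; exact hwb _) ht).sub
      (intervalIntegrable_layer hγ hmw hnw (fun r => by rw [abs_neg]; exact hwb _) ht)
    refine this.congr fun r _ => ?_
    simp only [hq]
    ring
  have hsplit : ∀ r, Real.exp (-γ * r) * gauss r (x + front v t - front v (t - r)) * -v (t - r) -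
      Real.exp (-γ * r) * gauss r (x + front w t - front w (t - r)) * -w (t - r) = e r + q r := by
    intro r; simp only [he, hq]; ring
  simp_rw [hsplit]
  rw [intervalIntegral.integral_add hie hiq]
  -- Here `e^{-γr}` is discarded; the weight supplies `e^{-λr}`, and the time kernel at rate `λ`
  -- gives `1/(2√λ)`.
  have h1 : |∫ r in 0..t, e r| ≤ D * Real.exp (lam * t) / (2 * √lam) := by
    refine abs_intervalIntegral_le_of_le_timeKernel hlam ht (by positivity) fun r hr hrt => ?_
    simp only [he]
    rw [abs_mul, abs_of_nonneg (mul_nonneg (Real.exp_pos _).le (gauss_nonneg _ _)), abs_sub_comm]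
    have h2 := hD (t - r) (sub_nonneg.2 hrt)
    have h3 : Real.exp (-γ * r) ≤ 1 := by rw [Real.exp_le_one_iff]; nlinarith
    have h4 : Real.exp (lam * (t - r)) = Real.exp (lam * t) * Real.exp (-lam * r) := by
      rw [← Real.exp_add]; ring_nf
    calc _ ≤ (1 * (1 / √(4 * Real.pi * r))) * (D * Real.exp (lam * (t - r))) := by
          refine mul_le_mul (mul_le_mul h3 (gauss_le hr.le _) (gauss_nonneg _ _) zero_le_one) h2
            (abs_nonneg _) (by positivity)
      _ = _ := by rw [h4, timeKernel]; ring
  have h2 : |∫ r in 0..t, q r| ≤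
      V * (D * Real.exp (lam * t)) / (2 * √lam) / (2 * √γ) := by
    refine abs_intervalIntegral_le_of_le_timeKernel hγ ht (by positivity) fun r hr hrt => ?_
    simp only [hq]
    rw [abs_mul, abs_mul, abs_of_pos (Real.exp_pos _), abs_neg]
    have h3 := abs_gauss_sub_le hr (x + front v t - front v (t - r)) (x + front w t - front w (t - r))
    have h4 := abs_front_sub_front_le hv hw hlam hD (sub_nonneg.2 hrt) (by linarith : t - r ≤ t)
    rw [sub_sub_cancel] at h4
    rw [show x + front v t - front v (t - r) - (x + front w t - front w (t - r)) =
      front v t - front v (t - r) - (front w t - front w (t - r)) by ring] at h3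
    have hsr : 0 < √r := Real.sqrt_pos.2 hr
    calc _ ≤ Real.exp (-γ * r) * ((D * Real.exp (lam * t) * (√r / √lam)) / (2 * √r) /
            √(4 * Real.pi * r)) * V := by
          refine mul_le_mul (mul_le_mul_of_nonneg_left (h3.trans ?_) (Real.exp_pos _).le)
            (hwb _) (abs_nonneg _) (by positivity)
          gcongr
      _ = _ := by rw [timeKernel]; field_simp
  refine (abs_add_le _ _).trans ((add_le_add h1 h2).trans (le_of_eq ?_))
  field_simp
  ring

theorem abs_temperature_sub_le (hγ : 0 < γ) (hlam : 0 < lam) (hu : Continuous u)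
    (hN : ∀ x, |u x| ≤ N) (hv : Continuous v) (hw : Continuous w) (hvb : ∀ t, |v t| ≤ V)
    (hwb : ∀ t, |w t| ≤ V) (hD : ∀ t, 0 ≤ t → |v t - w t| ≤ D * Real.exp (lam * t)) {t : ℝ}
    (ht : 0 ≤ t) :
    |temperature γ u v t (front v t) - temperature γ u w t (front w t)| ≤
      D * Real.exp (lam * t) * ((4 * N + 1 / 2 + V / (4 * √γ)) / √lam) := by
  have hD0 : 0 ≤ D := by
    have := (abs_nonneg _).trans (hD 0 le_rfl); simpa using this
  have hN0 : 0 ≤ N := (abs_nonneg _).trans (hN 0)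
  have hV0 : 0 ≤ V := (abs_nonneg _).trans (hvb 0)
  have hs0 : 0 < √lam := Real.sqrt_pos.2 hlam
  have hsγ : 0 < √γ := Real.sqrt_pos.2 hγ
  have hini : |initialPart γ u t (front v t) - initialPart γ u t (front w t)| ≤
      D * Real.exp (lam * t) * (4 * N / √lam) := by
    rcases ht.eq_or_lt with rfl | ht
    · rw [front_zero, front_zero, sub_self, abs_zero]; positivity
    -- With `α = 0` the weights are `1`, whence `4N`; the `√t` from the front difference cancels the
    -- smoothing loss.
    · have h1 := abs_initialPart_sub_le hγ.le (α := 0) le_rfl ht hu (by simpa using hN)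
        (front v t) (front w t)
      have h2 := abs_front_sub_front_le hv hw hlam hD le_rfl ht.le
      rw [front_zero, front_zero, sub_zero, sub_zero, sub_zero] at h2
      have hst : 0 < √t := Real.sqrt_pos.2 ht
      refine h1.trans ?_
      calc _ = |front v t - front w t| / √t * (4 * N) := by
            norm_num; ring_nf; simp
        _ ≤ (D * Real.exp (lam * t) * (√t / √lam)) / √t * (4 * N) := by gcongr
        _ = _ := by field_simp
  have hint := abs_interfacePart_moving_sub_le hγ hlam hv hw hvb hwb hD ht 0
  rw [zero_add, zero_add] at hint
  calc _ ≤ |initialPart γ u t (front v t) - initialPart γ u t (front w t)| +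
        |interfacePart γ v t (front v t) - interfacePart γ w t (front w t)| := by
        rw [temperature, temperature, add_sub_add_comm]; exact abs_add_le _ _
    _ ≤ _ := by
        refine (add_le_add hini hint).trans (le_of_eq ?_)
        ring

end Temperature

/-! ### The equation for the velocity -/

/-- A velocity for kinetics defined on the whole line, extended by a constant to negative times. -/
structure IsExtendedVelocity (G : ℝ → ℝ) (γ : ℝ) (u v : ℝ → ℝ) : Prop where
  continuous : Continuous v
  eq : ∀ t, v t = G (temperature γ u v (max t 0) (front v (max t 0)))

section Velocity

variable {γ V N L lam : ℝ} {G u u' v w : ℝ → ℝ}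

theorem IsExtendedVelocity.abs_le (h : IsExtendedVelocity G γ u v) (hG : ∀ x, |G x| ≤ V) (t : ℝ) :
    |v t| ≤ V := by rw [h.eq]; exact hG _

/-- Banach's fixed point theorem for `q = e^{-λt} v` among bounded continuous functions; `hlamL`
makes the contraction constant `1/2`. -/
theorem exists_isExtendedVelocity (hγ : 0 < γ) (hL : ∀ x y, |G x - G y| ≤ L * |x - y|)
    (hG : ∀ x, |G x| ≤ V) (hu : Continuous u) (hN : ∀ x, |u x| ≤ N) (hlam : 0 < lam)
    (hlamL : L * ((4 * N + 1 / 2 + V / (4 * √γ)) / √lam) ≤ 1 / 2) :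
    ∃ v, IsExtendedVelocity G γ u v := by
  have hV0 : 0 ≤ V := (abs_nonneg _).trans (hG 0)
  have hL0 : 0 ≤ L := by
    have := (abs_nonneg _).trans (hL 1 0); simpa using this
  have hGc : Continuous G :=
    (LipschitzWith.of_dist_le_mul (K := ⟨L, hL0⟩) fun x y => hL x y).continuous
  -- Clamping to `[-V, V]` makes every `q` an admissible velocity; it is inactive at the fixed point
  -- because `|G| ≤ V`.
  let vel : BoundedContinuousFunction ℝ ℝ → ℝ → ℝ := fun q t =>
    max (-V) (min V (Real.exp (lam * max t 0) * q (max t 0)))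
  have hvelc : ∀ q, Continuous (vel q) := fun q => by
    have : Continuous q := q.continuous
    fun_prop
  have hvelb : ∀ q t, |vel q t| ≤ V := fun q t =>
    abs_le.2 ⟨le_max_left _ _, max_le (by linarith) (min_le_left _ _)⟩
  have hveld : ∀ q q' t, 0 ≤ t → |vel q t - vel q' t| ≤ dist q q' * Real.exp (lam * t) := by
    intro q q' t ht
    have h1 : |vel q t - vel q' t| ≤
        |min V (Real.exp (lam * max t 0) * q (max t 0)) -
          min V (Real.exp (lam * max t 0) * q' (max t 0))| := by
      have := abs_max_sub_max_le_max (-V) (min V (Real.exp (lam * max t 0) * q (max t 0)))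
        (-V) (min V (Real.exp (lam * max t 0) * q' (max t 0)))
      simpa using this
    have h2 := abs_min_sub_min_le_max V (Real.exp (lam * max t 0) * q (max t 0))
      V (Real.exp (lam * max t 0) * q' (max t 0))
    rw [sub_self, abs_zero, sup_eq_right.2 (abs_nonneg (_ - _))] at h2
    refine h1.trans (h2.trans ?_)
    rw [max_eq_left ht, ← mul_sub, abs_mul, abs_of_pos (Real.exp_pos _), mul_comm]
    gcongr
    exact q.dist_coe_le_dist t
  let F : BoundedContinuousFunction ℝ ℝ → ℝ → ℝ := fun q t =>
    Real.exp (-(lam * max t 0)) *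
      G (temperature γ u (vel q) (max t 0) (front (vel q) (max t 0)))
  have hFc : ∀ q, Continuous (F q) := fun q => by
    refine Continuous.mul (by fun_prop) (hGc.comp ?_)
    exact continuous_temperature hγ hu hN (hvelc q) (hvelb q) (by fun_prop)
      (fun t => le_max_right _ _) ((continuous_front (hvelc q)).comp (by fun_prop))
  have hFb : ∀ q t, ‖F q t‖ ≤ V := fun q t => by
    rw [norm_mul, Real.norm_of_nonneg (Real.exp_pos _).le]
    have h1 : Real.exp (-(lam * max t 0)) ≤ 1 := by
      rw [Real.exp_le_one_iff]
      have := mul_nonneg hlam.le (le_max_right t 0)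
      linarith
    have := mul_le_mul h1 (hG (temperature γ u (vel q) (max t 0) (front (vel q) (max t 0))))
      (abs_nonneg _) zero_le_one
    simpa using this
  let Φ : BoundedContinuousFunction ℝ ℝ → BoundedContinuousFunction ℝ ℝ := fun q =>
    BoundedContinuousFunction.ofNormedAddCommGroup (F q) (hFc q) V (hFb q)
  have hΦ : ContractingWith (1 / 2) Φ := by
    refine ⟨by rw [← NNReal.coe_lt_coe]; norm_num, LipschitzWith.of_dist_le_mul fun q q' => ?_⟩
    rw [BoundedContinuousFunction.dist_le (by positivity)]
    intro t
    have ht : 0 ≤ max t 0 := le_max_right _ _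
    have h1 := abs_temperature_sub_le hγ hlam hu hN (hvelc q) (hvelc q') (hvelb q) (hvelb q')
      (hveld q q') ht
    change |F q t - F q' t| ≤ _
    simp only [F]
    rw [← mul_sub, abs_mul, abs_of_pos (Real.exp_pos _)]
    have h2 := (hL _ _).trans (mul_le_mul_of_nonneg_left h1 hL0)
    have h3 : Real.exp (-(lam * max t 0)) * Real.exp (lam * max t 0) = 1 := by
      rw [← Real.exp_add]; simp
    calc _ ≤ Real.exp (-(lam * max t 0)) * (L * (dist q q' * Real.exp (lam * max t 0) *
          ((4 * N + 1 / 2 + V / (4 * √γ)) / √lam))) := by gcongr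
      _ = (Real.exp (-(lam * max t 0)) * Real.exp (lam * max t 0)) *
          (L * ((4 * N + 1 / 2 + V / (4 * √γ)) / √lam)) * dist q q' := by ring
      _ ≤ _ := by
          rw [h3, one_mul]
          refine mul_le_mul_of_nonneg_right (hlamL.trans (le_of_eq ?_)) dist_nonneg
          simp
  let q := ContractingWith.fixedPoint Φ hΦ
  have hfix : Φ q = q := hΦ.fixedPoint_isFixedPt
  have hq : ∀ t, q t = F q t := fun t => by
    conv_lhs => rw [← hfix]
    rfl
  refine ⟨vel q, hvelc q, fun t => ?_⟩
  have h1 : Real.exp (lam * max t 0) * q (max t 0) =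
      G (temperature γ u (vel q) (max t 0) (front (vel q) (max t 0))) := by
    rw [hq]
    simp only [F]
    rw [max_eq_left (le_max_right t 0), ← mul_assoc, ← Real.exp_add]
    simp
  have h2 := abs_le.1 (hG (temperature γ u (vel q) (max t 0) (front (vel q) (max t 0))))
  calc vel q t = max (-V) (min V (Real.exp (lam * max t 0) * q (max t 0))) := rfl
    _ = _ := by rw [h1, min_eq_right h2.2, max_eq_right h2.1]

/-- Continuous dependence of the velocity on the initial data. -/
theorem abs_velocity_sub_le {M d : ℝ} (hγ : 0 < γ) (hL : ∀ x y, |G x - G y| ≤ L * |x - y|)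
    (hG : ∀ x, |G x| ≤ V) (hu : Continuous u) (hN : ∀ x, |u x| ≤ N) (hu' : Continuous u')
    (hM : ∀ x, |u' x| ≤ M) (hd : ∀ x, |u x - u' x| ≤ d) (hlam : 0 < lam)
    (hlamL : L * ((4 * N + 1 / 2 + V / (4 * √γ)) / √lam) ≤ 1 / 2)
    (hv : IsExtendedVelocity G γ u v) (hw : IsExtendedVelocity G γ u' w) {t : ℝ} (ht : 0 ≤ t) :
    |v t - w t| ≤ 2 * L * d * Real.exp (lam * t) := by
  have hL0 : 0 ≤ L := by
    have := (abs_nonneg _).trans (hL 1 0); simpa using this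
  have hd0 : 0 ≤ d := (abs_nonneg _).trans (hd 0)
  have one_le : ∀ t, 0 ≤ t → 1 ≤ Real.exp (lam * t) := fun t ht =>
    Real.one_le_exp (mul_nonneg hlam.le ht)
  -- A bound with constant `D` improves to `Ld + D/2`. Iterated from the trivial bound `2V`, the
  -- constants tend to the fixed value `2Ld`.
  have step : ∀ D, (∀ t, 0 ≤ t → |v t - w t| ≤ D * Real.exp (lam * t)) →
      ∀ t, 0 ≤ t → |v t - w t| ≤ (L * d + D / 2) * Real.exp (lam * t) := by
    intro D hD t ht
    have hD0 : 0 ≤ D := by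
      have := (abs_nonneg _).trans (hD 0 le_rfl); simpa using this
    have h1 := abs_temperature_sub_le hγ hlam hu hN hv.continuous hw.continuous (hv.abs_le hG)
      (hw.abs_le hG) hD ht
    have h2 : |temperature γ u w t (front w t) - temperature γ u' w t (front w t)| ≤
        d * Real.exp (lam * t) := by
      rw [temperature, temperature, add_sub_add_right_eq_sub, initialPart_sub ht hu hu' hN hM]
      refine (abs_initialPart_le ht hd _).trans ?_
      have h3 : Real.exp (-γ * t) ≤ 1 := by rw [Real.exp_le_one_iff]; nlinarith
      nlinarith [one_le t ht]
    rw [hv.eq t, hw.eq t, max_eq_left ht]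
    refine (hL _ _).trans ?_
    have h3 := abs_sub_le (temperature γ u v t (front v t)) (temperature γ u w t (front w t))
      (temperature γ u' w t (front w t))
    have h4 := mul_le_mul_of_nonneg_left (h3.trans (add_le_add h1 h2)) hL0
    refine h4.trans ?_
    have h5 := mul_le_mul_of_nonneg_left hlamL (mul_nonneg hD0 (Real.exp_pos (lam * t)).le)
    linarith
  have iter : ∀ n : ℕ, ∀ t, 0 ≤ t →
      |v t - w t| ≤ (2 * L * d + 2 * V * (1 / 2) ^ n) * Real.exp (lam * t) := by
    intro n
    induction n with
    | zero =>
      intro t ht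
      have h1 := (abs_sub (v t) (w t)).trans (add_le_add (hv.abs_le hG t) (hw.abs_le hG t))
      have hV0 : 0 ≤ V := (abs_nonneg _).trans (hG 0)
      have h2 : 0 ≤ L * d := mul_nonneg hL0 hd0
      rw [pow_zero]
      nlinarith [one_le t ht]
    | succ n ih =>
      intro t ht
      refine (step _ ih t ht).trans (le_of_eq ?_)
      ring
  have hlim : Tendsto (fun n : ℕ => (2 * L * d + 2 * V * (1 / 2 : ℝ) ^ n) * Real.exp (lam * t))
      atTop (𝓝 ((2 * L * d + 2 * V * 0) * Real.exp (lam * t))) :=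
    (((tendsto_pow_atTop_nhds_zero_of_lt_one (by norm_num) (by norm_num)).const_mul _).const_add
      _).mul_const _
  rw [mul_zero, add_zero] at hlim
  exact ge_of_tendsto' hlim fun n => iter n t ht

theorem exists_rate (L N V γ : ℝ) : ∃ lam > 0,
    L * ((4 * N + 1 / 2 + V / (4 * √γ)) / √lam) ≤ 1 / 2 := by
  set c := L * (4 * N + 1 / 2 + V / (4 * √γ)) with hc
  refine ⟨(2 * |c| + 1) ^ 2, by positivity, ?_⟩
  rw [Real.sqrt_sq (by positivity), ← mul_div_assoc, ← hc, div_le_iff₀ (by positivity)]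
  linarith [le_abs_self c]

end Velocity

/-! ### Extension of the kinetics to the whole line -/

/-- `G` is a Lipschitz extension of the kinetic function `g` from `J` to the line, with the same
bounds. -/
structure IsExtension (J : Set ℝ) (g G : ℝ → ℝ) (v₀ V₀ L : ℝ) : Prop where
  domain : J = Ici 0 ∨ J = univ
  pos : 0 < v₀
  lipschitz : ∀ x y, |G x - G y| ≤ L * |x - y|
  bounds : ∀ x, -V₀ ≤ G x ∧ G x ≤ -v₀
  eqOn : EqOn G g J

/-- The mean value inequality on the convex set `J` gives a Lipschitz constant, preserved by the
1-Lipschitz retraction `x ↦ max x 0`. -/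
theorem IsKinetics.exists_isExtension {J : Set ℝ} {g : ℝ → ℝ} {v₀ V₀ : ℝ}
    (hg : IsKinetics J g v₀ V₀) (hJ : J = Ici 0 ∨ J = univ) (hv₀ : 0 < v₀) :
    ∃ G L, IsExtension J g G v₀ V₀ L := by
  obtain ⟨C, hC⟩ := hg.deriv_bounded
  have hconv : Convex ℝ J := by
    rcases hJ with rfl | rfl
    exacts [convex_Ici 0, convex_univ]
  have h0 : (0 : ℝ) ∈ J := by
    rcases hJ with rfl | rfl
    exacts [self_mem_Ici, trivial]
  have hC0 : 0 ≤ C := (abs_nonneg _).trans (hC 0 h0)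
  have hlip : ∀ x ∈ J, ∀ y ∈ J, |g x - g y| ≤ C * |x - y| := fun x hx y hy =>
    Convex.norm_image_sub_le_of_norm_derivWithin_le hg.differentiable hC hconv hy hx
  rcases hJ with rfl | rfl
  · refine ⟨fun x => g (max x 0), C, Or.inl rfl, hv₀, fun x y => ?_,
      fun x => hg.bounds _ (le_max_right x 0), fun x hx => ?_⟩
    · refine (hlip _ (le_max_right x 0) _ (le_max_right y 0)).trans ?_
      refine mul_le_mul_of_nonneg_left ?_ hC0
      have := abs_max_sub_max_le_max x 0 y 0
      simpa using this
    · exact congrArg g (max_eq_left hx)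
  · exact ⟨g, C, Or.inr rfl, hv₀, fun x y => hlip x trivial y trivial,
      fun x => hg.bounds x trivial, fun _ _ => rfl⟩

/-- The interface velocity, extended by a constant to negative times. -/
noncomputable def extVelocity (J : Set ℝ) (g : ℝ → ℝ) (γ : ℝ) (u : ℝ → ℝ) (t : ℝ) : ℝ :=
  velocity J g γ u (max t 0)

theorem eqOn_extVelocity (J : Set ℝ) (g : ℝ → ℝ) (γ : ℝ) (u : ℝ → ℝ) :
    EqOn (velocity J g γ u) (extVelocity J g γ u) (Ici 0) := fun t ht => by
  rw [extVelocity, max_eq_left (mem_Ici.1 ht)]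

/-! ### Well-posedness of the velocity equation and the resulting evolution -/

section Evolution

variable {J : Set ℝ} {g G : ℝ → ℝ} {γ v₀ V₀ L α : ℝ}

namespace IsExtension

theorem abs_le (h : IsExtension J g G v₀ V₀ L) (x : ℝ) : |G x| ≤ V₀ := by
  have := h.bounds x
  have := h.pos
  exact _root_.abs_le.2 ⟨by linarith, by linarith⟩

theorem isClosed (h : IsExtension J g G v₀ V₀ L) : IsClosed J := by
  rcases h.domain with rfl | rfl
  exacts [isClosed_Ici, isClosed_univ]

theorem convex (h : IsExtension J g G v₀ V₀ L) : Convex ℝ J := by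
  rcases h.domain with rfl | rfl
  exacts [convex_Ici 0, convex_univ]

theorem zero_mem (h : IsExtension J g G v₀ V₀ L) : (0 : ℝ) ∈ J := by
  rcases h.domain with rfl | rfl
  exacts [self_mem_Ici, trivial]

theorem mem_of_nonneg (h : IsExtension J g G v₀ V₀ L) {x : ℝ} (hx : 0 ≤ x) : x ∈ J := by
  rcases h.domain with rfl | rfl
  exacts [hx, trivial]

theorem add_mem (h : IsExtension J g G v₀ V₀ L) {x y : ℝ} (hx : x ∈ J) (hy : y ∈ J) :
    x + y ∈ J := by
  rcases h.domain with rfl | rfl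
  exacts [add_nonneg (mem_Ici.1 hx) (mem_Ici.1 hy), trivial]

theorem initialPart_mem (h : IsExtension J g G v₀ V₀ L) {u : ℝ → ℝ} (hu : ∀ x, u x ∈ J) {t : ℝ}
    (ht : 0 ≤ t) (x : ℝ) : initialPart γ u t x ∈ J := by
  rcases h.domain with rfl | rfl
  exacts [initialPart_nonneg ht hu x, trivial]

/-- The values of `G` are negative, so the interface potential is nonnegative and the temperature
never leaves `J`, where `G` and `g` agree. -/
theorem isVelocity (h : IsExtension J g G v₀ V₀ L) {u v : ℝ → ℝ} (hu : ∀ x, u x ∈ J)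
    (hv : IsExtendedVelocity G γ u v) : IsVelocity J g γ u v := by
  have hmem : ∀ t : ℝ, 0 ≤ t → temperature γ u v t (front v t) ∈ J := fun t ht =>
    h.add_mem (h.initialPart_mem hu ht _) (h.mem_of_nonneg
      (interfacePart_nonneg (fun t => by rw [hv.eq]; linarith [(h.bounds (temperature γ u v
        (max t 0) (front v (max t 0)))).2, h.pos]) ht _))
  refine ⟨hv.continuous.continuousOn, hmem, fun t ht => ?_⟩
  rw [← h.eqOn (hmem t ht), hv.eq t, max_eq_left ht]

theorem isExtendedVelocity (h : IsExtension J g G v₀ V₀ L) {u w : ℝ → ℝ}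
    (hw : IsVelocity J g γ u w) : IsExtendedVelocity G γ u fun t => w (max t 0) := by
  have hEq : EqOn w (fun t => w (max t 0)) (Ici 0) := fun t ht => by
    simp only
    rw [max_eq_left (mem_Ici.1 ht)]
  refine ⟨hw.continuousOn.comp_continuous (by fun_prop) fun t => mem_Ici.2 (le_max_right t 0),
    fun t => ?_⟩
  have ht : 0 ≤ max t 0 := le_max_right _ _
  rw [← temperature_congr u hEq ht, ← front_congr hEq ht, h.eqOn (hw.mem _ ht), ← hw.kinetic _ ht]

theorem existsUnique_velocity (h : IsExtension J g G v₀ V₀ L) (hγ : 0 < γ) (hα : 0 ≤ α)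
    {u : WeightedC α} (hu : u ∈ phaseSpace J α) :
    ∃ v, IsVelocity J g γ u v ∧ ∀ w, IsVelocity J g γ u w → EqOn w v (Ici 0) := by
  obtain ⟨lam, hlam, hrate⟩ := exists_rate L ‖u‖ V₀ γ
  obtain ⟨v, hv⟩ := exists_isExtendedVelocity hγ h.lipschitz h.abs_le u.continuous
    (u.abs_apply_le_norm hα) hlam hrate
  refine ⟨v, h.isVelocity hu hv, fun w hw t ht => ?_⟩
  -- Uniqueness is continuous dependence with equal data.
  have h1 := abs_velocity_sub_le (d := 0) hγ h.lipschitz h.abs_le u.continuous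
    (u.abs_apply_le_norm hα) u.continuous (u.abs_apply_le_norm hα) (by simp) hlam hrate
    (h.isExtendedVelocity hw) hv (mem_Ici.1 ht)
  rw [mul_zero, zero_mul, max_eq_left (mem_Ici.1 ht)] at h1
  exact sub_eq_zero.1 (abs_nonpos_iff.1 h1)

theorem isVelocity_velocity (h : IsExtension J g G v₀ V₀ L) (hγ : 0 < γ) (hα : 0 ≤ α)
    {u : WeightedC α} (hu : u ∈ phaseSpace J α) : IsVelocity J g γ u (velocity J g γ u) := by
  obtain ⟨v, hv, -⟩ := h.existsUnique_velocity hγ hα hu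
  exact Classical.epsilon_spec ⟨v, hv⟩

theorem isExtendedVelocity_extVelocity (h : IsExtension J g G v₀ V₀ L) (hγ : 0 < γ) (hα : 0 ≤ α)
    {u : WeightedC α} (hu : u ∈ phaseSpace J α) :
    IsExtendedVelocity G γ u (extVelocity J g γ u) :=
  h.isExtendedVelocity (h.isVelocity_velocity hγ hα hu)

end IsExtension

theorem profile₁_eq (J : Set ℝ) (g : ℝ → ℝ) (γ : ℝ) (u : ℝ → ℝ) {t : ℝ} (ht : 0 ≤ t) (x : ℝ) :
    profile₁ J g γ t u x =
      interfacePart γ (extVelocity J g γ u) t (x + front (extVelocity J g γ u) t) := by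
  rw [profile₁, interfacePart_congr (eqOn_extVelocity J g γ u) ht,
    front_congr (eqOn_extVelocity J g γ u) ht]

theorem profile₂_eq (J : Set ℝ) (g : ℝ → ℝ) (γ : ℝ) (u : ℝ → ℝ) {t : ℝ} (ht : 0 ≤ t) (x : ℝ) :
    profile₂ J g γ t u x = initialPart γ u t (x + front (extVelocity J g γ u) t) := by
  rw [profile₂, front_congr (eqOn_extVelocity J g γ u) ht]

/-! ### Profiles in the moving frame, semigroup law and dissipativity -/

/-- The Hölder constant of the potentials of the interface. -/
noncomputable def holderConst (γ V₀ : ℝ) : ℝ :=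
  V₀ * ∫ r in Ioi (0 : ℝ), r ^ (-(3 / 4) : ℝ) * Real.exp (-γ * r)

theorem exp_neg_mul_abs_add_le {α V₀ t s : ℝ} (hα : 0 ≤ α) (hs : |s| ≤ V₀ * t) (x : ℝ) :
    Real.exp (-α * |x + s|) ≤ Real.exp (α * V₀ * t) * Real.exp (-α * |x|) := by
  have h1 := exp_neg_mul_abs_le hα x (x + s)
  rw [sub_add_cancel_left, abs_neg, mul_comm (Real.exp _)] at h1
  refine h1.trans (mul_le_mul_of_nonneg_right (Real.exp_le_exp.2 ?_) (Real.exp_pos _).le)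
  rw [mul_assoc]
  exact mul_le_mul_of_nonneg_left hs hα

namespace IsExtension

theorem profile₁_nonneg (h : IsExtension J g G v₀ V₀ L) (hγ : 0 < γ) (hα : 0 ≤ α)
    {u : WeightedC α} (hu : u ∈ phaseSpace J α) {t : ℝ} (ht : 0 ≤ t) (x : ℝ) :
    0 ≤ profile₁ J g γ t u x := by
  have hv := h.isExtendedVelocity_extVelocity hγ hα hu
  rw [profile₁_eq J g γ u ht]
  exact interfacePart_nonneg (fun t => by
    rw [hv.eq]; linarith [(h.bounds (temperature γ u (extVelocity J g γ u) (max t 0)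
      (front (extVelocity J g γ u) (max t 0)))).2, h.pos]) ht _

/-- The rate `β` is independent of the weight `α` of the phase space; the later choice `β > α` is
the source of compactness. -/
theorem profile₁_mem_decayClass (h : IsExtension J g G v₀ V₀ L) (hγ : 0 < γ) (hV₀ : 0 < V₀)
    (hα : 0 ≤ α) {β : ℝ} (hβ : 0 ≤ β) (hκ : 0 < kappa γ V₀ β) {u : WeightedC α}
    (hu : u ∈ phaseSpace J α) {t : ℝ} (ht : 0 ≤ t) :
    profile₁ J g γ t u ∈ decayClass β (V₀ / √γ) (holderConst γ V₀) := by
  have hv := h.isExtendedVelocity_extVelocity hγ hα hu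
  refine ⟨fun x => ?_, fun x y => ?_⟩
  · rw [abs_of_nonneg (h.profile₁_nonneg hγ hα hu ht x), profile₁_eq J g γ u ht]
    exact interfacePart_le_exp_abs hγ hV₀ hv.continuous (hv.abs_le h.abs_le) hβ hκ ht x
  · rw [profile₁_eq J g γ u ht, profile₁_eq J g γ u ht]
    have := abs_interfacePart_sub_le hγ hv.continuous (hv.abs_le h.abs_le) ht
      (x + front (extVelocity J g γ u) t) (y + front (extVelocity J g γ u) t)
    rwa [add_sub_add_right_eq_sub] at this

theorem abs_front_le (h : IsExtension J g G v₀ V₀ L) (hγ : 0 < γ) (hα : 0 ≤ α)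
    {u : WeightedC α} (hu : u ∈ phaseSpace J α) {t : ℝ} (ht : 0 ≤ t) :
    |front (extVelocity J g γ u) t| ≤ V₀ * t := by
  have hv := h.isExtendedVelocity_extVelocity hγ hα hu
  have := abs_front_sub_le hv.continuous (hv.abs_le h.abs_le) 0 t
  rwa [front_zero, sub_zero, sub_zero, abs_of_nonneg ht] at this

theorem abs_profile₂_le (h : IsExtension J g G v₀ V₀ L) (hγ : 0 < γ) (hα : 0 ≤ α)
    {u : WeightedC α} (hu : u ∈ phaseSpace J α) {t : ℝ} (ht : 0 ≤ t) (x : ℝ) :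
    |profile₂ J g γ t u x| ≤
      2 * Real.exp (-kappa γ V₀ α * t) * ‖u‖ * Real.exp (-α * |x|) := by
  rw [profile₂_eq J g γ u ht]
  refine (abs_initialPart_le_exp hα ht u.abs_apply_le _).trans ?_
  calc _ ≤ 2 * ‖u‖ * Real.exp ((α ^ 2 - γ) * t) *
          (Real.exp (α * V₀ * t) * Real.exp (-α * |x|)) := by
        gcongr
        exact exp_neg_mul_abs_add_le hα (h.abs_front_le hγ hα hu ht) x
    _ = 2 * (Real.exp ((α ^ 2 - γ) * t) * Real.exp (α * V₀ * t)) * ‖u‖ *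
          Real.exp (-α * |x|) := by ring
    _ = _ := by
        rw [← Real.exp_add, kappa]
        ring_nf

theorem profile₂_mem_weightedSubmodule (h : IsExtension J g G v₀ V₀ L) (hγ : 0 < γ) (hα : 0 ≤ α)
    {u : WeightedC α} (hu : u ∈ phaseSpace J α) {t : ℝ} (ht : 0 ≤ t) :
    profile₂ J g γ t u ∈ weightedSubmodule α := by
  refine WeightedC.mem_weightedSubmodule ?_ (h.abs_profile₂_le hγ hα hu ht)
  simp_rw [funext fun x => profile₂_eq J g γ u ht x]
  exact continuous_initialPart u.continuous (u.abs_apply_le_norm hα) continuous_const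
    (fun _ => ht) (by fun_prop)

theorem profile₁_mem_weightedSubmodule (h : IsExtension J g G v₀ V₀ L) (hγ : 0 < γ)
    (hV₀ : 0 < V₀) (hα : 0 ≤ α) (hκ : 0 < kappa γ V₀ α) {u : WeightedC α}
    (hu : u ∈ phaseSpace J α) {t : ℝ} (ht : 0 ≤ t) :
    profile₁ J g γ t u ∈ weightedSubmodule α :=
  decayClass_subset_weightedSubmodule le_rfl
    (h.profile₁_mem_decayClass hγ hV₀ hα hα hκ hu ht)

theorem norm_T₂_le (h : IsExtension J g G v₀ V₀ L) (hγ : 0 < γ) (hα : 0 ≤ α)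
    {u : WeightedC α} (hu : u ∈ phaseSpace J α) {t : ℝ} (ht : 0 ≤ t) :
    ‖T₂ J g γ α t u‖ ≤ 2 * Real.exp (-kappa γ V₀ α * t) * ‖u‖ :=
  WeightedC.norm_le_of_forall fun x => by
    rw [T₂, WeightedC.ofFun_apply (h.profile₂_mem_weightedSubmodule hγ hα hu ht)]
    exact h.abs_profile₂_le hγ hα hu ht x

theorem norm_T₁_le (h : IsExtension J g G v₀ V₀ L) (hγ : 0 < γ) (hV₀ : 0 < V₀) (hα : 0 ≤ α)
    (hκ : 0 < kappa γ V₀ α) {u : WeightedC α} (hu : u ∈ phaseSpace J α) {t : ℝ} (ht : 0 ≤ t) :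
    ‖T₁ J g γ α t u‖ ≤ V₀ / √γ :=
  WeightedC.norm_le_of_forall fun x => by
    rw [T₁, WeightedC.ofFun_apply (h.profile₁_mem_weightedSubmodule hγ hV₀ hα hκ hu ht)]
    exact (h.profile₁_mem_decayClass hγ hV₀ hα hα hκ hu ht).1 x

theorem T_apply (h : IsExtension J g G v₀ V₀ L) (hγ : 0 < γ) (hV₀ : 0 < V₀) (hα : 0 ≤ α)
    (hκ : 0 < kappa γ V₀ α) {u : WeightedC α} (hu : u ∈ phaseSpace J α) {t : ℝ} (ht : 0 ≤ t)
    (x : ℝ) : T J g γ α t u x = temperature γ u (extVelocity J g γ u) t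
      (x + front (extVelocity J g γ u) t) := by
  rw [T, WeightedC.add_apply, T₁, T₂,
    WeightedC.ofFun_apply (h.profile₁_mem_weightedSubmodule hγ hV₀ hα hκ hu ht),
    WeightedC.ofFun_apply (h.profile₂_mem_weightedSubmodule hγ hα hu ht),
    profile₁_eq J g γ u ht, profile₂_eq J g γ u ht, add_comm, temperature]

theorem T₁_mem (h : IsExtension J g G v₀ V₀ L) (hγ : 0 < γ) (hV₀ : 0 < V₀) (hα : 0 ≤ α)
    (hκ : 0 < kappa γ V₀ α) {u : WeightedC α} (hu : u ∈ phaseSpace J α) {t : ℝ} (ht : 0 ≤ t) :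
    T₁ J g γ α t u ∈ phaseSpace J α := fun x => by
  rw [T₁, WeightedC.ofFun_apply (h.profile₁_mem_weightedSubmodule hγ hV₀ hα hκ hu ht)]
  exact h.mem_of_nonneg (h.profile₁_nonneg hγ hα hu ht x)

theorem T_mem (h : IsExtension J g G v₀ V₀ L) (hγ : 0 < γ) (hV₀ : 0 < V₀) (hα : 0 ≤ α)
    (hκ : 0 < kappa γ V₀ α) {u : WeightedC α} (hu : u ∈ phaseSpace J α) {t : ℝ} (ht : 0 ≤ t) :
    T J g γ α t u ∈ phaseSpace J α := fun x => by
  rw [T, WeightedC.add_apply]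
  refine h.add_mem (h.T₁_mem hγ hV₀ hα hκ hu ht x) ?_
  rw [T₂, WeightedC.ofFun_apply (h.profile₂_mem_weightedSubmodule hγ hα hu ht),
    profile₂_eq J g γ u ht]
  exact h.initialPart_mem hu ht _

theorem T_zero (h : IsExtension J g G v₀ V₀ L) (hγ : 0 < γ) (hV₀ : 0 < V₀) (hα : 0 ≤ α)
    (hκ : 0 < kappa γ V₀ α) {u : WeightedC α} (hu : u ∈ phaseSpace J α) :
    T J g γ α 0 u = u := WeightedC.ext fun x => by
  rw [h.T_apply hγ hV₀ hα hκ hu le_rfl, front_zero, add_zero, temperature, initialPart_zero,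
    interfacePart_zero, add_zero]

/-- The shifted velocity `v (r + ·)` solves the velocity problem for the restarted data, so
uniqueness identifies it with the velocity issuing from `T r u`. -/
theorem T_add (h : IsExtension J g G v₀ V₀ L) (hγ : 0 < γ) (hV₀ : 0 < V₀) (hα : 0 ≤ α)
    (hκ : 0 < kappa γ V₀ α) {u : WeightedC α} (hu : u ∈ phaseSpace J α) {t r : ℝ} (ht : 0 ≤ t)
    (hr : 0 ≤ r) : T J g γ α (t + r) u = T J g γ α t (T J g γ α r u) := by
  have hv := h.isExtendedVelocity_extVelocity hγ hα hu
  have hvel := h.isVelocity hu hv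
  set v := extVelocity J g γ u with hvdef
  have hr' := h.T_mem hγ hV₀ hα hκ hu hr
  have hTr : ⇑(T J g γ α r u) = fun y => temperature γ u v r (y + front v r) :=
    funext fun y => h.T_apply hγ hV₀ hα hκ hu hr y
  have hrestart : ∀ b, 0 ≤ b → ∀ x, temperature γ (T J g γ α r u) (fun τ => v (r + τ)) b x =
      temperature γ u v (r + b) (x + front v r) := fun b hb x => by
    rw [hTr]
    exact temperature_restart hγ u.continuous (u.abs_apply_le_norm hα) hv.continuous
      (hv.abs_le h.abs_le) hr hb x
  have hshift : IsVelocity J g γ (T J g γ α r u) fun τ => v (r + τ) := by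
    have hfr : ∀ b, front (fun τ => v (r + τ)) b + front v r = front v (r + b) := fun b => by
      rw [front_comp_add_left hv.continuous]; ring
    refine ⟨(hv.continuous.comp (by fun_prop)).continuousOn, fun b hb => ?_, fun b hb => ?_⟩
    · rw [hrestart b hb, hfr]
      exact hvel.mem _ (add_nonneg hr hb)
    · rw [hrestart b hb, hfr]
      exact hvel.kinetic _ (add_nonneg hr hb)
  have hEq : EqOn (extVelocity J g γ (T J g γ α r u)) (fun τ => v (r + τ)) (Ici 0) := by
    obtain ⟨w, -, hw⟩ := h.existsUnique_velocity hγ hα hr'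
    have h1 := hw _ hshift
    have h2 := hw _ (h.isVelocity_velocity hγ hα hr')
    exact (eqOn_extVelocity J g γ _).symm.trans (h2.trans h1.symm)
  refine WeightedC.ext fun x => ?_
  rw [h.T_apply hγ hV₀ hα hκ hu (add_nonneg ht hr), h.T_apply hγ hV₀ hα hκ hr' ht,
    temperature_congr _ hEq ht, front_congr hEq ht, hrestart t ht,
    front_comp_add_left hv.continuous, add_comm t r]
  congr 1
  ring

theorem isWellDefined (h : IsExtension J g G v₀ V₀ L) (hγ : 0 < γ) (hV₀ : 0 < V₀) (hα : 0 ≤ α)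
    (hκ : 0 < kappa γ V₀ α) : IsWellDefined J g γ α where
  velocity_unique _ hu := h.existsUnique_velocity hγ hα hu
  profile₁_mem _ hu _ ht := h.profile₁_mem_weightedSubmodule hγ hV₀ hα hκ hu ht
  profile₂_mem _ hu _ ht := h.profile₂_mem_weightedSubmodule hγ hα hu ht
  mapsTo _ ht _ hu := h.T_mem hγ hV₀ hα hκ hu ht
  zero _ hu := h.T_zero hγ hV₀ hα hκ hu
  add _ hu _ _ ht hr := h.T_add hγ hV₀ hα hκ hu ht hr

/-- `T₁` never exceeds `V₀/√γ` in norm; the margin `ε` is for the decaying `T₂`. -/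
theorem isAbsorbing_ball (h : IsExtension J g G v₀ V₀ L) (hγ : 0 < γ) (hV₀ : 0 < V₀) (hα : 0 ≤ α)
    (hκ : 0 < kappa γ V₀ α) {ε : ℝ} (hε : 0 < ε) :
    IsAbsorbing (T J g γ α) (phaseSpace J α) (ball J α (V₀ / √γ + ε)) := by
  intro X hXP hXb
  obtain ⟨R, hR⟩ := isBounded_iff_forall_norm_le.1 hXb
  have hlim : Tendsto (fun t => 2 * Real.exp (-(kappa γ V₀ α * t)) * R) atTop (𝓝 (2 * 0 * R)) :=
    ((Real.tendsto_exp_neg_atTop_nhds_zero.comp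
      (tendsto_id.const_mul_atTop hκ)).const_mul 2).mul_const R
  rw [mul_zero, zero_mul] at hlim
  obtain ⟨t₁, ht₁⟩ := eventually_atTop.1 (hlim.eventually (ge_mem_nhds hε))
  refine ⟨max t₁ 0, le_max_right _ _, ?_⟩
  rintro t ht _ ⟨u, hu, rfl⟩
  have ht0 : 0 ≤ t := (le_max_right _ _).trans ht
  refine ⟨h.T_mem hγ hV₀ hα hκ (hXP hu) ht0, (norm_add_le _ _).trans
    (add_le_add (h.norm_T₁_le hγ hV₀ hα hκ (hXP hu) ht0)
      ((h.norm_T₂_le hγ hα (hXP hu) ht0).trans ?_))⟩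
  refine le_trans ?_ (ht₁ t ((le_max_left _ _).trans ht))
  rw [neg_mul]
  gcongr
  exact hR u hu

/-! ### Continuity of the evolution operators -/

theorem abs_extVelocity_sub_le (h : IsExtension J g G v₀ V₀ L) (hγ : 0 < γ) (hα : 0 ≤ α)
    {lam : ℝ} (hlam : 0 < lam) {u w : WeightedC α}
    (hrate : L * ((4 * ‖u‖ + 1 / 2 + V₀ / (4 * √γ)) / √lam) ≤ 1 / 2)
    (hu : u ∈ phaseSpace J α) (hw : w ∈ phaseSpace J α) {t : ℝ} (ht : 0 ≤ t) :
    |extVelocity J g γ u t - extVelocity J g γ w t| ≤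
      2 * L * ‖u - w‖ * Real.exp (lam * t) :=
  abs_velocity_sub_le hγ h.lipschitz h.abs_le u.continuous (u.abs_apply_le_norm hα) w.continuous
    (w.abs_apply_le_norm hα) (fun x => (u - w).abs_apply_le_norm hα x) hlam hrate
    (h.isExtendedVelocity_extVelocity hγ hα hu) (h.isExtendedVelocity_extVelocity hγ hα hw) ht

theorem tendsto_norm_sub (u : WeightedC α) (s : Set (WeightedC α)) :
    Tendsto (fun w => ‖u - w‖) (𝓝[s] u) (𝓝 0) := by
  have hc : Continuous fun w : WeightedC α => ‖u - w‖ := by fun_prop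
  have := hc.tendsto u
  rw [sub_self, norm_zero] at this
  exact this.mono_left nhdsWithin_le_nhds

/-- Pointwise convergence of profiles is enough, since all of them lie in one decay class, where it
implies convergence in norm. -/
theorem continuousOn_T₁ (h : IsExtension J g G v₀ V₀ L) (hγ : 0 < γ) (hV₀ : 0 < V₀) (hα : 0 ≤ α)
    {β : ℝ} (hαβ : α < β) (hκ : 0 < kappa γ V₀ β) {t : ℝ} (ht : 0 ≤ t) :
    ContinuousOn (T₁ J g γ α t) (phaseSpace J α) := by
  have hprofile : ContinuousOn (fun u : WeightedC α => profile₁ J g γ t u) (phaseSpace J α) := by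
    refine continuousOn_pi.2 fun x u hu => tendsto_iff_dist_tendsto_zero.2 ?_
    obtain ⟨lam, hlam, hrate⟩ := exists_rate L ‖u‖ V₀ γ
    have h0 := (((tendsto_norm_sub u (phaseSpace J α)).const_mul (2 * L)).mul_const
      (Real.exp (lam * t))).mul_const ((1 / 2 + V₀ / (4 * √γ)) / √lam)
    rw [mul_zero, zero_mul, zero_mul] at h0
    refine squeeze_zero' (Eventually.of_forall fun _ => dist_nonneg) ?_ h0
    filter_upwards [self_mem_nhdsWithin] with w hw
    have hvu := h.isExtendedVelocity_extVelocity hγ hα hu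
    have hvw := h.isExtendedVelocity_extVelocity hγ hα hw
    rw [dist_comm, Real.dist_eq, profile₁_eq J g γ _ ht, profile₁_eq J g γ _ ht]
    exact abs_interfacePart_moving_sub_le hγ hlam hvu.continuous hvw.continuous
      (hvu.abs_le h.abs_le) (hvw.abs_le h.abs_le)
      (fun τ hτ => h.abs_extVelocity_sub_le hγ hα hlam hrate hu hw hτ) ht x
  exact (continuousOn_ofFun_decayClass hα hαβ (V₀ / √γ) (holderConst γ V₀)).comp hprofile
    fun u hu => h.profile₁_mem_decayClass hγ hV₀ hα (hα.trans hαβ.le) hκ hu ht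

/-- The same data are compared at two front positions, then two data at the same position. The
factor `1/√t` excludes `t = 0`, where `T` is the identity on the phase space. -/
theorem norm_T₂_sub_le (h : IsExtension J g G v₀ V₀ L) (hγ : 0 < γ) (hα : 0 ≤ α)
    {u w : WeightedC α} (hu : u ∈ phaseSpace J α) (hw : w ∈ phaseSpace J α) {t : ℝ} (ht : 0 < t) :
    ‖T₂ J g γ α t u - T₂ J g γ α t w‖ ≤
      |front (extVelocity J g γ u) t - front (extVelocity J g γ w) t| / √t *
        (‖u‖ * (2 * Real.exp (α ^ 2 * (2 * t)) * (2 * Real.exp (α * V₀ * t)))) +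
      2 * ‖u - w‖ * Real.exp ((α ^ 2 - γ) * t) * Real.exp (α * V₀ * t) := by
  refine WeightedC.norm_le_of_forall fun x => ?_
  rw [WeightedC.sub_apply, T₂, T₂,
    WeightedC.ofFun_apply (h.profile₂_mem_weightedSubmodule hγ hα hu ht.le),
    WeightedC.ofFun_apply (h.profile₂_mem_weightedSubmodule hγ hα hw ht.le),
    profile₂_eq J g γ u ht.le, profile₂_eq J g γ w ht.le]
  have hsu := exp_neg_mul_abs_add_le hα (h.abs_front_le hγ hα hu ht.le) x
  have hsw := exp_neg_mul_abs_add_le hα (h.abs_front_le hγ hα hw ht.le) x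
  set su := front (extVelocity J g γ u) t
  set sw := front (extVelocity J g γ w) t
  have h1 := abs_initialPart_sub_le hγ.le hα ht u.continuous u.abs_apply_le (x + su) (x + sw)
  rw [add_sub_add_left_eq_sub] at h1
  have h2 := abs_initialPart_le_exp (γ := γ) hα ht.le (u - w).abs_apply_le (x + sw)
  have h3 := initialPart_sub (γ := γ) ht.le u.continuous w.continuous (u.abs_apply_le_norm hα)
    (w.abs_apply_le_norm hα) (x + sw)
  have h4 : (fun y => u y - w y) = ⇑(u - w) := rfl
  rw [h4] at h3
  rw [← h3] at h2
  refine (abs_sub_le _ (initialPart γ u t (x + sw)) _).trans ((add_le_add h1 h2).trans ?_)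
  rw [add_mul]
  refine add_le_add ?_ ?_
  · calc _ ≤ |su - sw| / √t * (‖u‖ * (2 * Real.exp (α ^ 2 * (2 * t)) *
          (Real.exp (α * V₀ * t) * Real.exp (-α * |x|) +
            Real.exp (α * V₀ * t) * Real.exp (-α * |x|)))) := by gcongr
      _ = _ := by ring
  · calc _ ≤ 2 * ‖u - w‖ * Real.exp ((α ^ 2 - γ) * t) *
          (Real.exp (α * V₀ * t) * Real.exp (-α * |x|)) := by gcongr
      _ = _ := by ring

theorem continuousOn_T₂ (h : IsExtension J g G v₀ V₀ L) (hγ : 0 < γ) (hα : 0 ≤ α) {t : ℝ}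
    (ht : 0 < t) : ContinuousOn (T₂ J g γ α t) (phaseSpace J α) := by
  intro u hu
  obtain ⟨lam, hlam, hrate⟩ := exists_rate L ‖u‖ V₀ γ
  have hn := tendsto_norm_sub u (phaseSpace J α)
  have hfront : Tendsto (fun w : WeightedC α =>
      |front (extVelocity J g γ u) t - front (extVelocity J g γ w) t|)
      (𝓝[phaseSpace J α] u) (𝓝 0) := by
    have h0 := ((hn.const_mul (2 * L)).mul_const (Real.exp (lam * t))).mul_const
      (√(t - 0) / √lam)
    rw [mul_zero, zero_mul, zero_mul] at h0
    refine squeeze_zero' (Eventually.of_forall fun _ => abs_nonneg _) ?_ h0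
    filter_upwards [self_mem_nhdsWithin] with w hw
    have := abs_front_sub_front_le (h.isExtendedVelocity_extVelocity hγ hα hu).continuous
      (h.isExtendedVelocity_extVelocity hγ hα hw).continuous hlam
      (fun τ hτ => h.abs_extVelocity_sub_le hγ hα hlam hrate hu hw hτ) le_rfl ht.le
    rwa [front_zero, front_zero, sub_zero, sub_zero] at this
  have hlim := ((hfront.div_const (√t)).mul_const
    (‖u‖ * (2 * Real.exp (α ^ 2 * (2 * t)) * (2 * Real.exp (α * V₀ * t))))).add
    (((hn.const_mul 2).mul_const (Real.exp ((α ^ 2 - γ) * t))).mul_const (Real.exp (α * V₀ * t)))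
  rw [zero_div, zero_mul, mul_zero, zero_mul, zero_mul, add_zero] at hlim
  refine tendsto_iff_dist_tendsto_zero.2
    (squeeze_zero' (Eventually.of_forall fun _ => dist_nonneg) ?_ hlim)
  filter_upwards [self_mem_nhdsWithin] with w hw
  rw [dist_comm, dist_eq_norm]
  exact h.norm_T₂_sub_le hγ hα hu hw ht

theorem continuousOn_T (h : IsExtension J g G v₀ V₀ L) (hγ : 0 < γ) (hV₀ : 0 < V₀) (hα : 0 ≤ α)
    (hκ : 0 < kappa γ V₀ α) {β : ℝ} (hαβ : α < β) (hκβ : 0 < kappa γ V₀ β) {t : ℝ} (ht : 0 ≤ t) :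
    ContinuousOn (T J g γ α t) (phaseSpace J α) := by
  rcases ht.eq_or_lt with rfl | ht
  · exact continuousOn_id.congr fun u hu => h.T_zero hγ hV₀ hα hκ hu
  · exact (h.continuousOn_T₁ hγ hV₀ hα hαβ hκβ ht.le).add (h.continuousOn_T₂ hγ hα ht)

end IsExtension

/-! ### The attractor -/

/-- A compact set that contains all potentials of the interface. -/
def interfaceCompact (J : Set ℝ) (γ V₀ α β : ℝ) : Set (WeightedC α) :=
  WeightedC.ofFun α '' decayClass β (V₀ / √γ) (holderConst γ V₀) ∩ phaseSpace J α

namespace IsExtension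

theorem isCompact_interfaceCompact (h : IsExtension J g G v₀ V₀ L) (hα : 0 ≤ α) {β : ℝ}
    (hαβ : α < β) : IsCompact (interfaceCompact J γ V₀ α β) :=
  (isCompact_image_decayClass hα hαβ _ _).inter_right (isClosed_phaseSpace h.isClosed α)

theorem T₁_mem_interfaceCompact (h : IsExtension J g G v₀ V₀ L) (hγ : 0 < γ) (hV₀ : 0 < V₀)
    (hα : 0 ≤ α) (hκ : 0 < kappa γ V₀ α) {β : ℝ} (hαβ : α < β) (hκβ : 0 < kappa γ V₀ β)
    {u : WeightedC α} (hu : u ∈ phaseSpace J α) {t : ℝ} (ht : 0 ≤ t) :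
    T₁ J g γ α t u ∈ interfaceCompact J γ V₀ α β :=
  ⟨⟨_, h.profile₁_mem_decayClass hγ hV₀ hα (hα.trans hαβ.le) hκβ hu ht, rfl⟩,
    h.T₁_mem hγ hV₀ hα hκ hu ht⟩

/-- The point `T₁(t)u` itself lies in the compact set, and its distance to `T(t)u` is the norm of
`T₂(t)u`. -/
theorem attractsExponentially_interfaceCompact (h : IsExtension J g G v₀ V₀ L) (hγ : 0 < γ)
    (hV₀ : 0 < V₀) (hα : 0 ≤ α) (hκ : 0 < kappa γ V₀ α) {β : ℝ} (hαβ : α < β)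
    (hκβ : 0 < kappa γ V₀ β) :
    AttractsExponentially (T J g γ α) (phaseSpace J α) (interfaceCompact J γ V₀ α β)
      (kappa γ V₀ α) := by
  intro X hXP hXb
  obtain ⟨R, hR⟩ := isBounded_iff_forall_norm_le.1 hXb
  refine ⟨2 * R, fun t ht u hu =>
    ⟨_, h.T₁_mem_interfaceCompact hγ hV₀ hα hκ hαβ hκβ (hXP hu) ht, ?_⟩⟩
  rw [dist_eq_norm, T, add_sub_cancel_left]
  refine (h.norm_T₂_le hγ hα (hXP hu) ht).trans ?_
  rw [mul_right_comm]
  gcongr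
  exact hR u hu

end IsExtension

/-! ### Positivity of the decay rate below the critical weights -/

/-- `alphaTime` is the positive root of `α² + αV₀ = γ`. -/
theorem kappa_pos_of_lt_alphaTime {γ V₀ α : ℝ} (hV₀ : 0 < V₀) (hα : 0 ≤ α)
    (h : α < alphaTime γ V₀) : 0 < kappa γ V₀ α := by
  rw [alphaTime] at h
  have h1 : 2 * α / V₀ + 1 < √(1 + 4 * γ / V₀ ^ 2) := by
    have h2 : 2 * α < V₀ * (√(1 + 4 * γ / V₀ ^ 2) - 1) := by linarith
    have h3 := (div_lt_iff₀' hV₀).2 h2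
    linarith
  have h2 := (Real.lt_sqrt (by positivity)).1 h1
  have h3 := mul_lt_mul_of_pos_right h2 (show 0 < V₀ ^ 2 by positivity)
  have e1 : (2 * α / V₀ + 1) ^ 2 * V₀ ^ 2 = (2 * α + V₀) ^ 2 := by field_simp
  have e2 : (1 + 4 * γ / V₀ ^ 2) * V₀ ^ 2 = V₀ ^ 2 + 4 * γ := by field_simp
  rw [e1, e2] at h3
  rw [kappa]
  nlinarith

/-- From `α < V₀/4` and `αV₀ < γ/2` it follows that `α² + αV₀ ≤ (5/4) αV₀ < γ`. -/
theorem kappa_pos_of_lt_alphaSpace {γ v₀ V₀ α : ℝ} (hγ : 0 < γ) (hV₀ : 0 < V₀) (hvV : v₀ ≤ V₀)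
    (hα : 0 ≤ α) (h : α < alphaSpace γ v₀ V₀) : 0 < kappa γ V₀ α := by
  obtain ⟨h1, h2⟩ := lt_min_iff.1 h
  rw [lt_div_iff₀ (by positivity)] at h2
  rw [kappa]
  nlinarith

end Evolution

end Stefan

open Stefan in
theorem mainTheorem2 (J : Set ℝ) (hJ : J = Set.Ici 0 ∨ J = Set.univ) (g : ℝ → ℝ)
    (γ v₀ V₀ : ℝ) (hγ : 0 < γ) (hv₀ : 0 < v₀) (hV₀ : 0 < V₀)
    (hg : Stefan.IsKinetics J g v₀ V₀) :
    (∀ α : ℝ, 0 ≤ α → α < Stefan.alphaTime γ V₀ →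
      Stefan.IsWellDefined J g γ α ∧
      0 < Stefan.kappa γ V₀ α ∧
      (∀ N t : ℝ, 0 ≤ t → ∀ u ∈ Stefan.ball J α N,
        ‖Stefan.T₂ J g γ α t u‖ ≤ 2 * Real.exp (-Stefan.kappa γ V₀ α * t) * N) ∧
      (∀ ε > 0, Stefan.IsAbsorbing (Stefan.T J g γ α) (Stefan.phaseSpace J α)
        (Stefan.ball J α (V₀ / Real.sqrt γ + ε)))) ∧
    (∀ α : ℝ, 0 ≤ α → α < Stefan.alphaSpace γ v₀ V₀ → ∀ N : ℝ, ∀ t₀ > 0,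
      IsCompact (closure (⋃ t ≥ t₀, Stefan.T₁ J g γ α t '' Stefan.ball J α N))) ∧
    (∀ α : ℝ, 0 ≤ α → α < min (Stefan.alphaTime γ V₀) (Stefan.alphaSpace γ v₀ V₀) →
      ∀ ε > 0, ∃ A : Set (Stefan.WeightedC α),
        A = omegaLimit Filter.atTop (Stefan.T J g γ α)
          (Stefan.ball J α (V₀ / Real.sqrt γ + ε)) ∧
        Stefan.IsGlobalAttractor (Stefan.T J g γ α) (Stefan.phaseSpace J α) A ∧
        Stefan.IsMaximalInvariant (Stefan.T J g γ α) (Stefan.phaseSpace J α) A ∧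
        IsConnected A ∧
        ∃ K ⊆ Stefan.phaseSpace J α, IsCompact K ∧ A ⊆ K ∧
          Stefan.AttractsExponentially (Stefan.T J g γ α) (Stefan.phaseSpace J α) K
            (Stefan.kappa γ V₀ α)) := by
  obtain ⟨G, L, h⟩ := hg.exists_isExtension hJ hv₀
  refine ⟨fun α hα hlt => ?_, fun α hα hlt N t₀ ht₀ => ?_, fun α hα hlt ε hε => ?_⟩
  · have hκ := kappa_pos_of_lt_alphaTime hV₀ hα hlt
    refine ⟨h.isWellDefined hγ hV₀ hα hκ, hκ, fun N t ht u hu => ?_,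
      fun ε hε => h.isAbsorbing_ball hγ hV₀ hα hκ hε⟩
    refine (h.norm_T₂_le hγ hα hu.1 ht).trans ?_
    gcongr
    exact hu.2
  · have hvV : v₀ ≤ V₀ := by linarith [h.bounds 0]
    -- A rate strictly between `α` and the critical weight still has `κ(β) > 0` and provides the
    -- surplus decay that compactness needs.
    obtain ⟨β, hαβ, hβ⟩ := exists_between hlt
    have hκ := kappa_pos_of_lt_alphaSpace hγ hV₀ hvV hα hlt
    have hκβ := kappa_pos_of_lt_alphaSpace hγ hV₀ hvV (hα.trans hαβ.le) hβ
    refine (h.isCompact_interfaceCompact (γ := γ) hα hαβ).closure_of_subset ?_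
    simp only [Set.iUnion_subset_iff]
    rintro t ht _ ⟨u, hu, rfl⟩
    exact h.T₁_mem_interfaceCompact hγ hV₀ hα hκ hαβ hκβ hu.1 (ht₀.le.trans ht)
  · obtain ⟨β, hαβ, hβ⟩ := exists_between (hlt.trans_le (min_le_left _ _))
    have hκ := kappa_pos_of_lt_alphaTime hV₀ hα (hlt.trans_le (min_le_left _ _))
    have hκβ := kappa_pos_of_lt_alphaTime hV₀ (hα.trans hαβ.le) hβ
    have habs := h.isAbsorbing_ball hγ hV₀ hα hκ hε
    have hK := h.isCompact_interfaceCompact (γ := γ) hα hαβ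
    have hatt := h.attractsExponentially_interfaceCompact hγ hV₀ hα hκ hαβ hκβ
    have hcont := fun t (ht : 0 ≤ t) => h.continuousOn_T hγ hV₀ hα hκ hαβ hκβ ht
    have hBP : ball J α (V₀ / √γ + ε) ⊆ phaseSpace J α := fun u hu => hu.1
    have hBb : Bornology.IsBounded (ball J α (V₀ / √γ + ε)) :=
      isBounded_iff_forall_norm_le.2 ⟨_, fun u hu => hu.2⟩
    have hBc : IsConnected (ball J α (V₀ / √γ + ε)) :=
      (convex_ball h.convex α _).isConnected
        ⟨0, fun _ => h.zero_mem, by rw [norm_zero]; positivity⟩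
    have hA := isGlobalAttractor_omegaLimit hκ (isClosed_phaseSpace h.isClosed α)
      (fun t ht u hu => h.T_mem hγ hV₀ hα hκ hu ht)
      (fun u hu t r ht hr => h.T_add hγ hV₀ hα hκ hu ht hr) hcont hBP hBb habs hK hatt
    exact ⟨_, rfl, hA, isMaximalInvariant_omegaLimit habs,
      isConnected_omegaLimit hκ hcont hBP hBb hBc hK hatt habs hA, _, Set.inter_subset_right, hK,
      subset_of_attractsExponentially hκ hK hatt hA.subset hA.isCompact.isBounded hA.invariant,
      hatt⟩
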